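/- Notation. $U(n)\subset\mathbb C^{n\times n}$ is the unitary group, $\|\cdot\|$ the Frobenius norm, and $\mathbb C^{n\times n}$ carries the real inner product $\operatorname{Re}\operatorname{tr}(X^{\mathsf H}Y)$. For a tensor $\mathcal A$ of order $m$ and size $n\times\cdots\times n$ and $0\le t\le m$ let $$(\mathcal A\bullet_t U)_{i_1\cdots i_m}=\sum_{j_1,\dots,j_m}\mathcal A_{j_1\cdots j_m}\,\overline{U_{j_1i_1}}\cdots\overline{U_{j_ti_t}}\;U_{j_{t+1}i_{t+1}}\cdots U_{j_mi_m},$$ let $\operatorname{diag}\mathcal A=(\mathcal A_{p\cdots p})_{p=1}^n$, and let $\operatorname{tr}\mathcal A$ be the sum of the diagonal entries. Cost functions. Let $d\le 3$, and let $f$ be of one of the forms (a) $f(U)=\sum_{\ell=1}^L\alpha_\ell\,\|\operatorname{diag}(\mathcal A^{(\ell)}\bullet_{t_\ell}U)\|^2$, with $\alpha_\ell\in\mathbb R$, complex tensors $\mathcal A^{(\ell)}$ of orders $d_\ell\le d$, and integers $0\le t_\ell\le d_\ell$; (b) $f(U)=\operatorname{tr}(\mathcal B\bullet_d U)$, with $\mathcal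 B$ a complex tensor of order $2d$ that is Hermitian: $\mathcal B_{i_1\cdots i_dj_1\cdots j_d}=\overline{\mathcal B_{j_1\cdots j_di_1\cdots i_d}}$. Riemannian derivatives. The tangent space to $U(n)$ at $U$ is $T_U=\{X\in\mathbb C^{n\times n}:X^{\mathsf H}U+U^{\mathsf H}X=0\}$, and $\operatorname{Exp}_U(X)=U\exp(U^{\mathsf H}X)$ for $X\in T_U$. The Riemannian gradient $\operatorname{grad}f(U)$ is the orthogonal projection of the Euclidean gradient $\nabla f(U)$ onto $T_U$, that is $\tfrac12U(U^{\mathsf H}\nabla f(U)-\nabla f(U)^{\mathsf H}U)$. The Riemannian Hessian of $f$ at $U$ is the Euclidean Hessian of $f\circ\operatorname{Exp}_U:T_U\to\mathbb R$ at $0$. Algorithm Jacobi-G (with $0<\delta\le\sqrt2/n$). For $i<j$ and $\Psi\in U(2)$ let $G^{(i,j,\Psi)}$ be the matrix that agrees with $I_n$ except that its entries at $(i,i),(i,j),(j,i),(j,j)$ are $\Psi_{11},\Psi_{12},\Psi_{21},\Psi_{22}$, and let $h_{(i,j),U}(\Psi)=f(U\,G^{(i,j,\Psi)})$. Starting from $U_0\in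 U(n)$, for $k=1,2,\dots$: choose any pair $i_k<j_k$ with $$\|\operatorname{grad}h_{(i_k,j_k),U_{k-1}}(I_2)\|\ge\delta\,\|\operatorname{grad}f(U_{k-1})\|;$$ choose any maximizer $\Psi_k$ of $h_{(i_k,j_k),U_{k-1}}$ over $U(2)$ of the form $$\Psi_k=\begin{bmatrix}c&-(s_1+is_2)\\ s_1-is_2&c\end{bmatrix},\qquad c,s_1,s_2\in\mathbb R,\quad c^2+s_1^2+s_2^2=1,\quad c\ge\tfrac{\sqrt2}{2};$$ and set $U_k=U_{k-1}G^{(i_k,j_k,\Psi_k)}$. Theorem. Let $U_*\in U(n)$ be a semi-strict local maximum point of $f$ on $U(n)$, that is, a local maximum point at which the Riemannian Hessian of $f$ has rank $n(n-1)$. Then there is a neighborhood $W$ of $U_*$ in $U(n)$ such that, for every $\delta\in(0,\sqrt2/n]$, every $U_0\in W$ and every infinite sequence $(U_k)$ of iterates of Algorithm Jacobi-G with parameter $\delta$ started at $U_0$, there are a diagonal unitary matrix $S$ and constants $C$ and $c>0$ with $$\|U_k-U_*S\|\le C\,e^{-ck}\qquad\text{for all }k\ge0.$$ -/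

import Mathlib

open Matrix Topology

-- Throughout, `‖X‖` is the Frobenius norm of a matrix.
attribute [local instance] Matrix.frobeniusNormedAddCommGroup Matrix.frobeniusNormedSpace

noncomputable section

namespace JacobiG

/-- A complex tensor (multi-way array) of order `d` and size `n × ⋯ × n`. -/
abbrev Tensor (n d : ℕ) : Type := (Fin d → Fin n) → ℂ

/-- The simultaneous contraction `A •₁ M₁ ⋯ •_d M_d` of all indices of `A` with matrices. -/
def Tensor.contract {n d : ℕ} (A : Tensor n d) (M : Fin d → Matrix (Fin n) (Fin n) ℂ) :
    Tensor n d :=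
  fun i => ∑ j : Fin d → Fin n, A j * ∏ k, M k (i k) (j k)

/-- The vector of diagonal entries `A_{p ⋯ p}`. -/
def Tensor.diag {n d : ℕ} (A : Tensor n d) : Fin n → ℂ := fun p => A fun _ => p

/-- The sum of the diagonal entries. -/
def Tensor.trace {n d : ℕ} (A : Tensor n d) : ℂ := ∑ p, A.diag p

/-- The rotated tensor `A •₁ Uᴴ ⋯ •_t Uᴴ •_{t+1} Uᵀ ⋯ •_d Uᵀ`. -/
def Tensor.rotate {n d : ℕ} (A : Tensor n d) (t : ℕ) (U : Matrix (Fin n) (Fin n) ℂ) :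
    Tensor n d :=
  A.contract fun k => if k.val < t then Uᴴ else Uᵀ

/-- A tensor of order `2d` is Hermitian if exchanging its first `d` indices with its last `d`
indices conjugates the entries. -/
def Tensor.IsHermitian {n d : ℕ} (B : Tensor n (d + d)) : Prop :=
  ∀ i j : Fin d → Fin n, B (Fin.append i j) = star (B (Fin.append j i))

/-- `f(U) = ∑_ℓ α_ℓ ‖diag (A^(ℓ) •₁ Uᴴ ⋯ •_{t_ℓ} Uᴴ •_{t_ℓ+1} Uᵀ ⋯ •_{d_ℓ} Uᵀ)‖²` for
finitely many tensors of orders `d_ℓ ≤ d`, integers `0 ≤ t_ℓ ≤ d_ℓ` and real `α_ℓ`. The formula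
makes sense for all square matrices, so `f` is regarded as a function on all of `ℂ^{n×n}`. -/
def IsNormCost {n : ℕ} (d : ℕ) (f : Matrix (Fin n) (Fin n) ℂ → ℝ) : Prop :=
  ∃ (L : ℕ) (ord t : Fin L → ℕ) (α : Fin L → ℝ) (A : ∀ l, Tensor n (ord l)),
    (∀ l, ord l ≤ d) ∧ (∀ l, t l ≤ ord l) ∧
    ∀ U, f U = ∑ l, α l * ∑ p, ‖((A l).rotate (t l) U).diag p‖ ^ 2

/-- `f(U) = tr (B •₁ Uᴴ ⋯ •_d Uᴴ •_{d+1} Uᵀ ⋯ •_{2d} Uᵀ)` for a Hermitian tensor `B` of order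
`2d` (the trace is then real for every matrix `U`). -/
def IsTraceCost {n : ℕ} (d : ℕ) (f : Matrix (Fin n) (Fin n) ℂ → ℝ) : Prop :=
  ∃ B : Tensor n (d + d), B.IsHermitian ∧ ∀ U, (f U : ℂ) = (B.rotate d U).trace

/-- The Euclidean gradient `∂f/∂X^Re + i ∂f/∂X^Im` for the real inner product
`Re tr (Xᴴ Y)` on `ℂ^{n×n}`. -/
def euclideanGradient {n : ℕ} (f : Matrix (Fin n) (Fin n) ℂ → ℝ)
    (X : Matrix (Fin n) (Fin n) ℂ) : Matrix (Fin n) (Fin n) ℂ :=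
  Matrix.of fun i j =>
    ((deriv (fun t : ℝ => f (X + Matrix.single i j (t : ℂ))) 0 : ℝ) : ℂ) +
      Complex.I * ((deriv (fun t : ℝ => f (X + Matrix.single i j (t * Complex.I))) 0 : ℝ) : ℂ)

/-- The Riemannian gradient `U Λ(U)` of `f` on the unitary group at `U`, where
`Λ(U) = (Uᴴ ∇f(U) - ∇f(U)ᴴ U) / 2`. -/
def riemannianGradient {n : ℕ} (f : Matrix (Fin n) (Fin n) ℂ → ℝ)
    (U : Matrix (Fin n) (Fin n) ℂ) : Matrix (Fin n) (Fin n) ℂ :=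
  U * ((1 / 2 : ℂ) • (Uᴴ * euclideanGradient f U - (euclideanGradient f U)ᴴ * U))

/-- The tangent space to the unitary group at `U`, a real subspace of `ℂ^{n×n}`. -/
def tangentSpace {n : ℕ} (U : Matrix (Fin n) (Fin n) ℂ) :
    Submodule ℝ (Matrix (Fin n) (Fin n) ℂ) where
  carrier := {X | Xᴴ * U + Uᴴ * X = 0}
  zero_mem' := by simp
  add_mem' := by
    intro X Y hX hY
    simp only [Set.mem_ofPred_eq] at *
    rw [conjTranspose_add, add_mul, mul_add, add_add_add_comm, hX, hY, add_zero]
  smul_mem' := by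
    intro r X hX
    simp only [Set.mem_ofPred_eq] at *
    rw [conjTranspose_smul, star_trivial, smul_mul_assoc, mul_smul_comm, ← smul_add, hX,
      smul_zero]

/-- The Riemannian exponential map `Exp_U(U Ω) = U exp Ω` of the unitary group. -/
def expMap {n : ℕ} (U X : Matrix (Fin n) (Fin n) ℂ) : Matrix (Fin n) (Fin n) ℂ :=
  U * NormedSpace.exp (Uᴴ * X)

/-- The Riemannian Hessian of `f` on the unitary group at `U`, as a bilinear form on the tangent
space: the Euclidean Hessian at the origin of `f ∘ Exp_U`. -/
def riemannianHessian {n : ℕ} (f : Matrix (Fin n) (Fin n) ℂ → ℝ)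
    (U : Matrix (Fin n) (Fin n) ℂ) : tangentSpace U →L[ℝ] tangentSpace U →L[ℝ] ℝ :=
  fderiv ℝ (fderiv ℝ fun X : tangentSpace U => f (expMap U X)) 0

/-- The rank of the Riemannian Hessian (of the bilinear form, equivalently of the self-adjoint
linear operator on the tangent space that represents it). -/
def hessianRank {n : ℕ} (f : Matrix (Fin n) (Fin n) ℂ → ℝ)
    (U : Matrix (Fin n) (Fin n) ℂ) : ℕ :=
  Module.finrank ℝ (LinearMap.range (riemannianHessian f U).toLinearMap)

/-- `U` is a local maximum point of `f` on the unitary group at which the Riemannian Hessian has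
rank `n(n-1)`. -/
def IsSemiStrictLocalMax {n : ℕ} (f : Matrix (Fin n) (Fin n) ℂ → ℝ)
    (U : unitaryGroup (Fin n) ℂ) : Prop :=
  IsLocalMax (fun V : unitaryGroup (Fin n) ℂ => f V) U ∧ hessianRank f U = n * (n - 1)

/-- The plane transformation: the identity matrix with `Ψ` put at the positions
`(i,i), (i,j), (j,i), (j,j)`. -/
def planeTransformation {n : ℕ} (i j : Fin n) (Ψ : Matrix (Fin 2) (Fin 2) ℂ) :
    Matrix (Fin n) (Fin n) ℂ :=
  Matrix.of fun a b =>
    if a = i ∧ b = i then Ψ 0 0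
    else if a = i ∧ b = j then Ψ 0 1
    else if a = j ∧ b = i then Ψ 1 0
    else if a = j ∧ b = j then Ψ 1 1
    else if a = b then 1 else 0

/-- The restriction `h(Ψ) = f(U G(Ψ))` of `f` to a pair `(i,j)`. -/
def restriction {n : ℕ} (f : Matrix (Fin n) (Fin n) ℂ → ℝ) (i j : Fin n)
    (U : Matrix (Fin n) (Fin n) ℂ) : Matrix (Fin 2) (Fin 2) ℂ → ℝ :=
  fun Ψ => f (U * planeTransformation i j Ψ)

/-- The rotation `Ψ(c, s₁, s₂)`. -/
def givensRotation (c s₁ s₂ : ℝ) : Matrix (Fin 2) (Fin 2) ℂ :=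
  !![(c : ℂ), -((s₁ : ℂ) + Complex.I * s₂); (s₁ : ℂ) - Complex.I * s₂, (c : ℂ)]

/-- `Ψ` is a Jacobi rotation for `h`: a maximizer of `h` over `U(2)` of the form
`Ψ(c, s₁, s₂)` with `c² + s₁² + s₂² = 1`, normalized by `c ≥ √2 / 2`. -/
def IsJacobiRotation (h : Matrix (Fin 2) (Fin 2) ℂ → ℝ) (Ψ : Matrix (Fin 2) (Fin 2) ℂ) : Prop :=
  (∃ c s₁ s₂ : ℝ, c ^ 2 + s₁ ^ 2 + s₂ ^ 2 = 1 ∧ √2 / 2 ≤ c ∧ Ψ = givensRotation c s₁ s₂) ∧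
    ∀ Φ ∈ unitaryGroup (Fin 2) ℂ, h Φ ≤ h Ψ

/-- `U₀, U₁, U₂, …` is a sequence of iterates of the Jacobi-G algorithm with parameter `δ`. -/
def IsJacobiGSequence {n : ℕ} (f : Matrix (Fin n) (Fin n) ℂ → ℝ) (δ : ℝ)
    (U : ℕ → unitaryGroup (Fin n) ℂ) : Prop :=
  ∀ k, ∃ i j : Fin n, i < j ∧
    δ * ‖riemannianGradient f (U k)‖ ≤ ‖riemannianGradient (restriction f i j (U k)) 1‖ ∧
    ∃ Ψ, IsJacobiRotation (restriction f i j (U k)) Ψ ∧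
      (U (k + 1) : Matrix (Fin n) (Fin n) ℂ) = U k * planeTransformation i j Ψ

/-- Linear convergence: `‖x_k - x‖ ≤ C e^{-ck}` for some constants `C` and `c > 0`. -/
def ConvergesLinearly {n : ℕ} (x : ℕ → Matrix (Fin n) (Fin n) ℂ)
    (x' : Matrix (Fin n) (Fin n) ℂ) : Prop :=
  ∃ C c : ℝ, 0 < c ∧ ∀ k : ℕ, ‖x k - x'‖ ≤ C * Real.exp (-c * k)

end JacobiG

end

/-! Every admissible `f` is a sum of one function over the columns of the matrix, and this function
ignores the phase of a column (`IsColumnCost`). Turning a plane rotation by a further right angle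
swaps its two columns up to phases, so along it `f` has period `π / 2`. As `d ≤ 3` bounds the
trigonometric degree by `6`, only the frequencies `0` and `4` survive: `f = A + B cos 4τ + C sin 4τ`
(`exists_eq_cos_sin`). This makes a Jacobi step explicit. Its gain is at least a constant times the
squared gradient of the restriction (`norm_gradient_restriction_sq_le`), hence, by the rule for
choosing pairs, at least a constant times `δ² ‖grad f‖²`.

By phase invariance `f` is constant on the orbit `U_* S`. The orbit directions form an
`n`-dimensional subspace of the kernel of the Hessian; since the Hessian has rank `n(n-1)`, they are
the whole kernel, and at a maximum the Hessian is negative definite transversally. If `w` is the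
distance to the orbit, then near it `f(U_*) - f(U)` lies between multiples of `w²` and `‖grad f(U)‖`
is at least a multiple of `w` (`orbit_estimates`). Together with the gain this gives `f(U_*) -
f(U_k) ≤ Γ (f(U_{k+1}) - f(U_k))`, so the deficit decays geometrically.

To pass from values to iterates, the length of a step must be controlled by its gain. On the orbit
every plane rotation has a strict maximum at angle zero, that is `B > 0` and `C = 0`; by compactness
`B ≥ β > 0` and `|C|` is small nearby (`eventually_coefficients`). With the normalization `c ≥ √2 /
2` the squared step is then at most a multiple of the gain, and the gain is at most `|C|`
(`jacobi_step`). Hence the iterates cannot leave the neighborhood, they converge linearly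
(`exists_linear_limit`), and their limit lies on the orbit. -/

namespace JacobiG

/-! ### Trigonometric polynomials -/

open Polynomial in
/-- `φ` is a trigonometric polynomial of degree at most `m`. -/
def IsTrig (m : ℕ) (φ : ℝ → ℂ) : Prop :=
  ∃ p : ℂ[X], p.natDegree ≤ 2 * m ∧
    ∀ τ : ℝ, φ τ * Complex.exp (τ * Complex.I) ^ m = p.eval (Complex.exp (τ * Complex.I))

namespace IsTrig

open Polynomial

variable {m k : ℕ} {φ ψ : ℝ → ℂ}

theorem const (c : ℂ) : IsTrig 0 fun _ => c :=
  ⟨C c, by simp, by simp⟩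

theorem add (hφ : IsTrig m φ) (hψ : IsTrig m ψ) : IsTrig m fun τ => φ τ + ψ τ := by
  obtain ⟨p, hp, hp'⟩ := hφ
  obtain ⟨q, hq, hq'⟩ := hψ
  exact ⟨p + q, natDegree_add_le_of_degree_le hp hq, fun τ => by
    rw [add_mul, hp', hq', eval_add]⟩

theorem mul (hφ : IsTrig m φ) (hψ : IsTrig k ψ) : IsTrig (m + k) fun τ => φ τ * ψ τ := by
  obtain ⟨p, hp, hp'⟩ := hφ
  obtain ⟨q, hq, hq'⟩ := hψ
  refine ⟨p * q, natDegree_mul_le.trans (by omega), fun τ => ?_⟩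
  rw [eval_mul, ← hp', ← hq', pow_add]
  ring

theorem mono (h : m ≤ k) (hφ : IsTrig m φ) : IsTrig k φ := by
  obtain ⟨p, hp, hp'⟩ := hφ
  refine ⟨p * X ^ (k - m), natDegree_mul_le.trans ?_, fun τ => ?_⟩
  · rw [natDegree_X_pow]; omega
  · rw [eval_mul, ← hp', eval_pow, eval_X, mul_assoc, ← pow_add, Nat.add_sub_cancel' h]

theorem sum {ι : Type*} (s : Finset ι) (f : ι → ℝ → ℂ) (h : ∀ i ∈ s, IsTrig m (f i)) :
    IsTrig m fun τ => ∑ i ∈ s, f i τ := by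
  classical
  induction s using Finset.induction_on with
  | empty => simpa using (const 0).mono (Nat.zero_le m)
  | insert a s ha ih =>
    simp only [Finset.sum_insert ha]
    exact (h a (by simp)).add (ih fun i hi => h i (by simp [hi]))

theorem prod {ι : Type*} (s : Finset ι) (f : ι → ℝ → ℂ) (h : ∀ i ∈ s, IsTrig 1 (f i)) :
    IsTrig s.card fun τ => ∏ i ∈ s, f i τ := by
  classical
  induction s using Finset.induction_on with
  | empty => simpa using const 1
  | insert a s ha ih =>
    simp only [Finset.prod_insert ha, Finset.card_insert_of_notMem ha]
    rw [add_comm]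
    exact (h a (by simp)).mul (ih fun i hi => h i (by simp [hi]))

theorem linear (x y : ℂ) :
    IsTrig 1 fun τ => (Real.cos τ : ℂ) * x + (Real.sin τ : ℂ) * y := by
  refine ⟨C ((x - Complex.I * y) / 2) * X ^ 2 + C ((x + Complex.I * y) / 2), ?_, fun τ => ?_⟩
  · compute_degree
  · have h : Complex.exp (τ * Complex.I) = Real.cos τ + Real.sin τ * Complex.I := by
      rw [Complex.exp_mul_I, Complex.ofReal_cos, Complex.ofReal_sin]
    have h1 : (Real.cos τ : ℂ) ^ 2 + (Real.sin τ : ℂ) ^ 2 = 1 := by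
      exact_mod_cast Real.cos_sq_add_sin_sq τ
    simp only [eval_add, eval_mul, eval_C, eval_pow, eval_X, h, pow_one]
    linear_combination (((Real.sin τ : ℂ) ^ 2 + 0) * ((-x + Complex.I * y) / 2)
      + (Real.cos τ : ℂ) * (Real.sin τ : ℂ) * y) * Complex.I_sq + ((x + Complex.I * y) / 2) * h1

/-- A real trigonometric polynomial of degree at most `6` and of period `π / 2` has only the
frequencies `0` and `4`. -/
theorem eq_of_period {φ : ℝ → ℝ} (h : IsTrig 6 fun τ => (φ τ : ℂ))
    (hper : ∀ τ, φ (τ + Real.pi / 2) = φ τ) :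
    ∃ A B C : ℝ, ∀ τ, φ τ = A + B * Real.cos (4 * τ) + C * Real.sin (4 * τ) := by
  obtain ⟨p, hp, hp'⟩ := h
  have key : ∀ τ : ℝ, (φ τ : ℂ) = p.coeff 6 + p.coeff 2 * Complex.exp (-(4 * τ * Complex.I))
      + p.coeff 10 * Complex.exp (4 * τ * Complex.I) := by
    intro τ
    set e := Complex.exp (τ * Complex.I) with he
    have hshift : ∀ σ : ℝ, Complex.exp ((σ + Real.pi / 2 : ℝ) * Complex.I)
        = Complex.I * Complex.exp (σ * Complex.I) := by
      intro σ
      rw [show ((σ + Real.pi / 2 : ℝ) : ℂ) * Complex.I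
        = Real.pi / 2 * Complex.I + σ * Complex.I by push_cast; ring, Complex.exp_add,
        Complex.exp_pi_div_two_mul_I]
    -- The shift by `π / 2` multiplies `e` by `i`, so the factor `e ^ 6` changes sign at each shift.
    -- The alternating average of the four identities keeps only the coefficients of `p` with index
    -- `2` modulo `4`; up to degree `12` these are `2`, `6` and `10`.
    have h0 := hp' τ
    have h1 := hp' (τ + Real.pi / 2)
    have h2 := hp' (τ + Real.pi / 2 + Real.pi / 2)
    have h3 := hp' (τ + Real.pi / 2 + Real.pi / 2 + Real.pi / 2)
    simp only [hshift, hper, ← he] at h0 h1 h2 h3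
    rw [eval_eq_sum_range' (n := 13) (by omega)] at h0 h1 h2 h3
    simp only [Finset.sum_range_succ, Finset.sum_range_zero] at h0 h1 h2 h3
    have hne : e ≠ 0 := Complex.exp_ne_zero _
    have hI : Complex.I ^ 2 = -1 := Complex.I_sq
    have h4 : Complex.exp (4 * τ * Complex.I) = e ^ 4 := by
      rw [he, ← Complex.exp_nat_mul]; congr 1; push_cast; ring
    rw [Complex.exp_neg, h4]
    field_simp
    have i3 : Complex.I ^ 3 = -Complex.I := by rw [pow_succ, hI]; ring
    have i4 : Complex.I ^ 4 = 1 := Complex.I_pow_four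
    have i5 : Complex.I ^ 5 = Complex.I := by rw [pow_succ, i4]; ring
    have i6 : Complex.I ^ 6 = -1 := by rw [pow_succ, i5, ← sq, hI]
    have i7 : Complex.I ^ 7 = -Complex.I := by rw [pow_succ, i6]; ring
    have i8 : Complex.I ^ 8 = 1 := by rw [pow_succ, i7, neg_mul, ← sq, hI]; ring
    have i9 : Complex.I ^ 9 = Complex.I := by rw [pow_succ, i8]; ring
    have i10 : Complex.I ^ 10 = -1 := by rw [pow_succ, i9, ← sq, hI]
    have i11 : Complex.I ^ 11 = -Complex.I := by rw [pow_succ, i10]; ring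
    have i12 : Complex.I ^ 12 = 1 := by rw [pow_succ, i11, neg_mul, ← sq, hI]; ring
    have e2 : Complex.I * (Complex.I * e) = -e := by rw [← mul_assoc, Complex.I_mul_I]; ring
    rw [e2] at h2 h3
    simp only [mul_pow, i3, i4, i5, i6, i7, i8, i9, i10, i11, i12, hI, pow_zero, pow_one, neg_pow e, neg_pow (Complex.I * e),
      mul_neg] at h0 h1 h2 h3
    refine mul_right_cancel₀ (pow_ne_zero 2 hne) ?_
    linear_combination (h0 - h1 + h2 - h3) / 4
  refine ⟨(p.coeff 6).re, (p.coeff 2).re + (p.coeff 10).re, (p.coeff 2).im - (p.coeff 10).im,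
    fun τ => ?_⟩
  have h := congrArg Complex.re (key τ)
  rw [show -(4 * (τ : ℂ) * Complex.I) = ((-(4 * τ) : ℝ) : ℂ) * Complex.I by push_cast; ring,
    show 4 * (τ : ℂ) * Complex.I = ((4 * τ : ℝ) : ℂ) * Complex.I by push_cast; ring,
    Complex.exp_mul_I, Complex.exp_mul_I, ← Complex.ofReal_cos, ← Complex.ofReal_sin,
    ← Complex.ofReal_cos, ← Complex.ofReal_sin, Real.cos_neg, Real.sin_neg] at h
  simp only [Complex.add_re, Complex.mul_re, Complex.ofReal_re, Complex.ofReal_im, Complex.I_re,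
    Complex.I_im, Complex.add_im, Complex.mul_im] at h
  rw [h]
  ring

end IsTrig

/-! ### The Frobenius norm and unitary matrices -/

section Norm

variable {n : ℕ} {X Y U : Matrix (Fin n) (Fin n) ℂ}

theorem frobenius_norm_sq {m : ℕ} (X : Matrix (Fin m) (Fin n) ℂ) :
    ‖X‖ ^ 2 = ∑ i, ∑ j, ‖X i j‖ ^ 2 := by
  rw [Matrix.frobenius_norm_def, ← Real.sqrt_eq_rpow, Real.sq_sqrt (by positivity)]
  simp

theorem ofReal_frobenius_norm_sq (X : Matrix (Fin n) (Fin n) ℂ) :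
    ((‖X‖ ^ 2 : ℝ) : ℂ) = (Xᴴ * X).trace := by
  rw [frobenius_norm_sq, Finset.sum_comm]
  simp only [Matrix.trace, Matrix.diag_apply, Matrix.mul_apply, conjTranspose_apply]
  push_cast
  refine Finset.sum_congr rfl fun i _ => Finset.sum_congr rfl fun j _ => ?_
  rw [RCLike.star_def, Complex.conj_mul']

theorem norm_entry_le (X : Matrix (Fin n) (Fin n) ℂ) (i j : Fin n) : ‖X i j‖ ≤ ‖X‖ := by
  refine abs_le_of_sq_le_sq' ?_ (norm_nonneg _) |>.2
  rw [frobenius_norm_sq]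
  exact (Finset.single_le_sum (f := fun b => ‖X i b‖ ^ 2) (fun _ _ => by positivity)
    (Finset.mem_univ j)).trans (Finset.single_le_sum (f := fun a => ∑ b, ‖X a b‖ ^ 2)
      (fun _ _ => by positivity) (Finset.mem_univ i))

theorem norm_unitary_mul (hU : U ∈ unitaryGroup (Fin n) ℂ) (X : Matrix (Fin n) (Fin n) ℂ) :
    ‖U * X‖ = ‖X‖ := by
  have h : ‖U * X‖ ^ 2 = ‖X‖ ^ 2 := by
    apply Complex.ofReal_injective
    rw [ofReal_frobenius_norm_sq, ofReal_frobenius_norm_sq, conjTranspose_mul, mul_assoc,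
      ← mul_assoc Uᴴ, ← star_eq_conjTranspose U, mem_unitaryGroup_iff'.1 hU, one_mul]
  exact (sq_eq_sq₀ (norm_nonneg _) (norm_nonneg _)).1 h

theorem norm_mul_unitary (hU : U ∈ unitaryGroup (Fin n) ℂ) (X : Matrix (Fin n) (Fin n) ℂ) :
    ‖X * U‖ = ‖X‖ := by
  rw [← frobenius_norm_conjTranspose, conjTranspose_mul, ← star_eq_conjTranspose U,
    norm_unitary_mul (Unitary.star_mem hU), frobenius_norm_conjTranspose]

theorem norm_trace_le (X : Matrix (Fin n) (Fin n) ℂ) : ‖X.trace‖ ≤ n * ‖X‖ := by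
  refine (norm_sum_le _ _).trans ?_
  refine (Finset.sum_le_sum fun i _ => norm_entry_le X i i).trans ?_
  simp

theorem diagonal_mem_unitaryGroup {z : Fin n → ℂ} (hz : ∀ i, ‖z i‖ = 1) :
    diagonal z ∈ unitaryGroup (Fin n) ℂ := by
  rw [mem_unitaryGroup_iff', star_eq_conjTranspose, diagonal_conjTranspose, diagonal_mul_diagonal,
    ← diagonal_one]
  congr 1
  funext i
  simp [Complex.conj_mul', hz i]

theorem norm_single (i j : Fin n) (z : ℂ) : ‖single i j z‖ = ‖z‖ := by
  refine (sq_eq_sq₀ (norm_nonneg _) (norm_nonneg _)).1 ?_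
  rw [frobenius_norm_sq, Finset.sum_eq_single i, Finset.sum_eq_single j]
  · simp
  · intro b _ hb
    simp [hb.symm]
  · simp
  · intro a _ ha
    simp [ha.symm]
  · simp

end Norm

/-! ### Both kinds of cost functions are sums over columns -/

/-- `f` is a sum of one and the same function over the columns of the matrix; the function is
smooth, does not see the phase of a column, and is a trigonometric polynomial of degree at most
`6` along the plane rotations. -/
def IsColumnCost {n : ℕ} (f : Matrix (Fin n) (Fin n) ℂ → ℝ) : Prop :=
  ∃ φ : (Fin n → ℂ) → ℝ, ContDiff ℝ ⊤ φ ∧ (∀ z : ℂ, ‖z‖ = 1 → ∀ u, φ (z • u) = φ u) ∧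
    (∀ u v : Fin n → ℂ,
      IsTrig 6 fun τ => (φ ((Real.cos τ : ℂ) • u + (Real.sin τ : ℂ) • v) : ℂ)) ∧
    ∀ U, f U = ∑ p, φ fun a => U a p

section Form

variable {n m : ℕ}

/-- The value of the form with tensor `A` on the vector `u`. -/
def Tensor.form (A : Tensor n m) (t : ℕ) (u : Fin n → ℂ) : ℂ :=
  ∑ j : Fin m → Fin n, A j * ∏ k : Fin m, if k.val < t then star (u (j k)) else u (j k)

theorem Tensor.diag_rotate (A : Tensor n m) (t : ℕ) (U : Matrix (Fin n) (Fin n) ℂ) (p : Fin n) :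
    (A.rotate t U).diag p = A.form t fun a => U a p := by
  simp only [Tensor.diag, Tensor.rotate, Tensor.contract, Tensor.form]
  refine Finset.sum_congr rfl fun j _ => ?_
  congr 1
  refine Finset.prod_congr rfl fun k _ => ?_
  split_ifs <;> rfl

theorem Tensor.contDiff_form (A : Tensor n m) (t : ℕ) : ContDiff ℝ ⊤ (A.form t) := by
  refine ContDiff.sum fun j _ => contDiff_const.mul (contDiff_prod fun k _ => ?_)
  split_ifs
  · exact Complex.conjCLE.contDiff.comp (contDiff_apply ℝ ℂ (j k))
  · exact contDiff_apply ℝ ℂ (j k)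

theorem Tensor.form_smul (A : Tensor n m) (t : ℕ) (z : ℂ) (u : Fin n → ℂ) :
    A.form t (z • u) = (∏ k : Fin m, if k.val < t then star z else z) * A.form t u := by
  simp only [Tensor.form, Finset.mul_sum]
  refine Finset.sum_congr rfl fun j _ => ?_
  rw [mul_left_comm, ← Finset.prod_mul_distrib]
  congr 1
  refine Finset.prod_congr rfl fun k _ => ?_
  split_ifs <;> simp

theorem Tensor.isTrig_form (A : Tensor n m) (t : ℕ) (u v : Fin n → ℂ) :
    IsTrig m fun τ => A.form t ((Real.cos τ : ℂ) • u + (Real.sin τ : ℂ) • v) := by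
  refine IsTrig.sum _ _ fun j _ => ?_
  have h : IsTrig m fun τ : ℝ => ∏ k : Fin m,
      if k.val < t then star (((Real.cos τ : ℂ) • u + (Real.sin τ : ℂ) • v) (j k))
      else ((Real.cos τ : ℂ) • u + (Real.sin τ : ℂ) • v) (j k) := by
    have h := IsTrig.prod (Finset.univ : Finset (Fin m)) (fun k τ =>
      if k.val < t then star (((Real.cos τ : ℂ) • u + (Real.sin τ : ℂ) • v) (j k))
      else ((Real.cos τ : ℂ) • u + (Real.sin τ : ℂ) • v) (j k)) fun k _ => ?_
    · simpa using h
    · split_ifs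
      · convert IsTrig.linear (star (u (j k))) (star (v (j k))) using 2 with τ
        simp only [Pi.add_apply, Pi.smul_apply, smul_eq_mul, star_add, star_mul', RCLike.star_def,
          Complex.conj_ofReal]
      · exact IsTrig.linear (u (j k)) (v (j k))
  simpa using (IsTrig.const (A j)).mul h

/-- Conjugation turns the form into a similar sum of products of `m` linear factors, because `cos τ`
and `sin τ` are real. Squared moduli and real parts of forms are built from a form and its
conjugate. -/
theorem Tensor.isTrig_star_form (A : Tensor n m) (t : ℕ) (u v : Fin n → ℂ) :
    IsTrig m fun τ => star (A.form t ((Real.cos τ : ℂ) • u + (Real.sin τ : ℂ) • v)) := by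
  obtain ⟨p, hp, hp'⟩ := A.isTrig_form t u v
  have hstar : ∀ τ : ℝ, star (A.form t ((Real.cos τ : ℂ) • u + (Real.sin τ : ℂ) • v)) =
      ∑ j : Fin m → Fin n, star (A j) * ∏ k : Fin m, if k.val < t then
        ((Real.cos τ : ℂ) * u (j k) + (Real.sin τ : ℂ) * v (j k)) else
        ((Real.cos τ : ℂ) * star (u (j k)) + (Real.sin τ : ℂ) * star (v (j k))) := by
    intro τ
    rw [Tensor.form, star_sum]
    refine Finset.sum_congr rfl fun j _ => ?_
    rw [star_mul', star_prod]
    congr 1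
    refine Finset.prod_congr rfl fun k _ => ?_
    split_ifs <;> simp only [Pi.add_apply, Pi.smul_apply, smul_eq_mul, star_add, star_mul',
      RCLike.star_def, Complex.conj_ofReal, Complex.conj_conj]
  simp only [hstar]
  refine IsTrig.sum _ _ fun j _ => ?_
  have h := IsTrig.prod (Finset.univ : Finset (Fin m)) (fun k τ => if k.val < t then
        ((Real.cos τ : ℂ) * u (j k) + (Real.sin τ : ℂ) * v (j k)) else
        ((Real.cos τ : ℂ) * star (u (j k)) + (Real.sin τ : ℂ) * star (v (j k)))) fun k _ => ?_
  · simpa using (IsTrig.const (star (A j))).mul h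
  · split_ifs <;> exact IsTrig.linear _ _

end Form

/-- A common phase of the column multiplies each form by a number of modulus one. The squared
modulus of a form of order `d_ℓ` has degree `2 d_ℓ ≤ 6`. -/
theorem IsNormCost.isColumnCost {n d : ℕ} (hd : d ≤ 3) {f : Matrix (Fin n) (Fin n) ℂ → ℝ}
    (hf : IsNormCost d f) : IsColumnCost f := by
  obtain ⟨L, ord, t, α, A, hord, -, hf⟩ := hf
  refine ⟨fun u => ∑ l, α l * ‖(A l).form (t l) u‖ ^ 2, ?_, ?_, ?_, ?_⟩
  · exact ContDiff.sum fun l _ => contDiff_const.mul (((A l).contDiff_form (t l)).norm_sq ℝ)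
  · intro z hz u
    refine Finset.sum_congr rfl fun l _ => ?_
    rw [Tensor.form_smul, norm_mul, norm_prod, Finset.prod_eq_one, one_mul]
    intro k _
    split_ifs <;> simp [hz]
  · intro u v
    have h : IsTrig 6 fun τ => ∑ l, (α l : ℂ) *
        (star ((A l).form (t l) ((Real.cos τ : ℂ) • u + (Real.sin τ : ℂ) • v)) *
          (A l).form (t l) ((Real.cos τ : ℂ) • u + (Real.sin τ : ℂ) • v)) :=
      IsTrig.sum _ _ fun l _ => ((IsTrig.const (α l : ℂ)).mul
        (((A l).isTrig_star_form (t l) u v).mul ((A l).isTrig_form (t l) u v))).mono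
          (by have := hord l; omega)
    refine (congrArg (IsTrig 6) (funext fun τ => ?_)).mp h
    rw [Complex.ofReal_sum]
    refine Finset.sum_congr rfl fun l _ => ?_
    rw [RCLike.star_def, Complex.conj_mul', Complex.ofReal_mul, Complex.ofReal_pow]
  · intro U
    simp only [hf, Tensor.diag_rotate, Finset.mul_sum]
    exact Finset.sum_comm

/-- The form has `d` conjugated and `d` plain factors, so a phase cancels, and its degree is `2d ≤
6`. As the trace equals the real number `f U`, taking real parts column by column loses nothing. -/
theorem IsTraceCost.isColumnCost {n d : ℕ} (hd : d ≤ 3) {f : Matrix (Fin n) (Fin n) ℂ → ℝ}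
    (hf : IsTraceCost d f) : IsColumnCost f := by
  obtain ⟨B, -, hf⟩ := hf
  refine ⟨fun u => (B.form d u).re, ?_, ?_, ?_, ?_⟩
  · exact Complex.reCLM.contDiff.comp (B.contDiff_form d)
  · intro z hz u
    beta_reduce
    rw [Tensor.form_smul, Fin.prod_univ_add]
    have : ((∏ k : Fin d, if ((Fin.castAdd d k : Fin (d + d)) : ℕ) < d then star z else z) *
        ∏ k : Fin d, if ((Fin.natAdd d k : Fin (d + d)) : ℕ) < d then star z else z) = 1 := by
      rw [← Finset.prod_mul_distrib]
      refine Finset.prod_eq_one fun k _ => ?_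
      rw [if_pos (by simp), if_neg (by simp), RCLike.star_def, Complex.conj_mul', hz]
      simp
    rw [this, one_mul]
  · intro u v
    have h := ((B.isTrig_form d u v).add (B.isTrig_star_form d u v))
    have h2 := ((IsTrig.const (1 / 2)).mul h).mono (k := 6) (by omega)
    refine (congrArg (IsTrig 6) (funext fun τ => ?_)).mp h2
    rw [RCLike.star_def, Complex.add_conj]
    push_cast
    ring
  · intro U
    have h := congrArg Complex.re (hf U)
    rw [Complex.ofReal_re, Tensor.trace, Complex.re_sum] at h
    simp only [h, Tensor.diag_rotate]

/-! ### Plane transformations and plane rotations -/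

section Plane

variable {n : ℕ} {i j : Fin n}

theorem planeTransformation_eq (hij : i ≠ j) (Ψ : Matrix (Fin 2) (Fin 2) ℂ) :
    planeTransformation i j Ψ = 1 + (single i i (Ψ 0 0 - 1) + single i j (Ψ 0 1) +
      single j i (Ψ 1 0) + single j j (Ψ 1 1 - 1)) := by
  ext a b
  simp only [planeTransformation, of_apply, Matrix.add_apply, one_apply, single_apply]
  by_cases hai : a = i
  · subst hai
    by_cases hba : b = a
    · subst hba; simp [hij.symm]
    · by_cases hbj : b = j
      · subst hbj; simp [hij, hij.symm]
      · simp [hba, hbj, Ne.symm hba, Ne.symm hbj]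
  · by_cases haj : a = j
    · subst haj
      by_cases hba : b = a
      · subst hba; simp [hai, hij]
      · by_cases hbi : b = i
        · subst hbi; simp [hai, hij]
        · simp [hba, hbi, hai, Ne.symm hba, Ne.symm hbi]
    · simp [hai, haj, Ne.symm hai, Ne.symm haj]

theorem mul_planeTransformation_apply (hij : i ≠ j) (U : Matrix (Fin n) (Fin n) ℂ)
    (Ψ : Matrix (Fin 2) (Fin 2) ℂ) (a p : Fin n) :
    (U * planeTransformation i j Ψ) a p =
      if p = i then Ψ 0 0 * U a i + Ψ 1 0 * U a j
      else if p = j then Ψ 1 1 * U a j + Ψ 0 1 * U a i else U a p := by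
  rw [planeTransformation_eq hij]
  simp only [mul_add, mul_one, Matrix.add_apply]
  by_cases hpi : p = i
  · subst hpi
    simp [hij]
    ring
  · by_cases hpj : p = j
    · subst hpj
      simp [hpi]
      ring
    · simp [hpi, hpj]

/-- The plane rotation in the direction `(a, b)` through the angle `τ`. -/
noncomputable def planeRotation (i j : Fin n) (a b τ : ℝ) : Matrix (Fin n) (Fin n) ℂ :=
  planeTransformation i j (givensRotation (Real.cos τ) (a * Real.sin τ) (b * Real.sin τ))

theorem givensRotation_mem_unitaryGroup {c s₁ s₂ : ℝ} (h : c ^ 2 + s₁ ^ 2 + s₂ ^ 2 = 1) :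
    givensRotation c s₁ s₂ ∈ unitaryGroup (Fin 2) ℂ := by
  have h' : (c : ℂ) ^ 2 + (s₁ : ℂ) ^ 2 + (s₂ : ℂ) ^ 2 = 1 := by exact_mod_cast h
  rw [mem_unitaryGroup_iff, star_eq_conjTranspose]
  have hI := Complex.I_sq
  ext a b
  fin_cases a <;> fin_cases b <;>
    simp [givensRotation, Matrix.mul_apply, Fin.sum_univ_two, conjTranspose_apply]
  · linear_combination h' - (s₂ : ℂ) ^ 2 * hI
  · ring
  · ring
  · linear_combination h' - (s₂ : ℂ) ^ 2 * hI

theorem planeTransformation_mem_unitaryGroup (hij : i ≠ j) {Ψ : Matrix (Fin 2) (Fin 2) ℂ}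
    (hΨ : Ψ ∈ unitaryGroup (Fin 2) ℂ) : planeTransformation i j Ψ ∈ unitaryGroup (Fin n) ℂ := by
  have h : ∀ a b, (Ψᴴ * Ψ) a b = (1 : Matrix (Fin 2) (Fin 2) ℂ) a b := fun a b => by
    rw [← star_eq_conjTranspose, mem_unitaryGroup_iff'.1 hΨ]
  have h00 := h 0 0
  have h01 := h 0 1
  have h10 := h 1 0
  have h11 := h 1 1
  simp only [Matrix.mul_apply, Fin.sum_univ_two, conjTranspose_apply, one_apply_eq,
    RCLike.star_def] at h00 h01 h10 h11
  rw [one_apply_ne (by decide)] at h01 h10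
  rw [mem_unitaryGroup_iff', star_eq_conjTranspose]
  have hs : (planeTransformation i j Ψ)ᴴ = planeTransformation i j Ψᴴ := by
    rw [planeTransformation_eq hij, planeTransformation_eq hij]
    simp only [conjTranspose_add, conjTranspose_one, conjTranspose_single, conjTranspose_apply,
      star_sub, star_one]
    abel
  rw [hs]
  ext a p
  rw [mul_planeTransformation_apply hij]
  simp only [planeTransformation, of_apply, conjTranspose_apply, one_apply]
  by_cases hai : a = i
  · subst hai
    by_cases hpa : p = a
    · subst hpa
      simp [hij.symm]
      linear_combination h00
    · by_cases hpj : p = j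
      · subst hpj
        simp [hij, hpa]
        linear_combination h01
      · simp [hpa, hpj, Ne.symm hpa]
  · by_cases haj : a = j
    · subst haj
      by_cases hpa : p = a
      · subst hpa
        simp [hij, hij.symm]
        linear_combination h11
      · by_cases hpi : p = i
        · subst hpi
          simp [hij, hij.symm]
          linear_combination h10
        · simp [hpa, hpi, Ne.symm hpa, hai]
    · by_cases hpi : p = i
      · subst hpi; simp [hai, haj]
      · by_cases hpj : p = j
        · subst hpj; simp [hai, haj]
        · simp [hai, haj, hpi, hpj]

theorem planeRotation_mem_unitaryGroup (hij : i ≠ j) {a b : ℝ} (hab : a ^ 2 + b ^ 2 = 1) (τ : ℝ) :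
    planeRotation i j a b τ ∈ unitaryGroup (Fin n) ℂ := by
  refine planeTransformation_mem_unitaryGroup hij (givensRotation_mem_unitaryGroup ?_)
  linear_combination Real.cos_sq_add_sin_sq τ + Real.sin τ ^ 2 * hab

theorem givensRotation_one : givensRotation 1 0 0 = 1 := by
  ext a b
  fin_cases a <;> fin_cases b <;> simp [givensRotation]

theorem planeTransformation_one (hij : i ≠ j) : planeTransformation i j 1 = 1 := by
  simp [planeTransformation_eq hij]

theorem planeRotation_zero (hij : i ≠ j) (a b : ℝ) : planeRotation i j a b 0 = 1 := by
  simp [planeRotation, givensRotation_one, planeTransformation_one hij]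

/-- The difference has two entries of squared modulus `1 - c²` and two of squared modulus `(1 -
c)²`. The triangle inequality and Cauchy–Schwarz for four terms give `4 (2(1 - c²) + 2(1 - c)²) = 16
(1 - c)`. -/
theorem norm_planeTransformation_givens_sub_one_sq_le (hij : i ≠ j) {c s₁ s₂ : ℝ}
    (h : c ^ 2 + s₁ ^ 2 + s₂ ^ 2 = 1) :
    ‖planeTransformation i j (givensRotation c s₁ s₂) - 1‖ ^ 2 ≤ 16 * (1 - c) := by
  have hσ : ‖(s₁ : ℂ) - Complex.I * s₂‖ ^ 2 = s₁ ^ 2 + s₂ ^ 2 := by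
    rw [Complex.sq_norm, Complex.normSq_apply]; simp; ring
  have hσ' : ‖-((s₁ : ℂ) + Complex.I * s₂)‖ ^ 2 = s₁ ^ 2 + s₂ ^ 2 := by
    rw [Complex.sq_norm, Complex.normSq_apply]; simp; ring
  have hc1 : ‖(c : ℂ) - 1‖ ^ 2 = (1 - c) ^ 2 := by
    rw [Complex.sq_norm, Complex.normSq_apply]; simp; ring
  rw [planeTransformation_eq hij, add_sub_cancel_left]
  have h1 := norm_add_le (single i i (givensRotation c s₁ s₂ 0 0 - 1) +
    single i j (givensRotation c s₁ s₂ 0 1) + single j i (givensRotation c s₁ s₂ 1 0))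
    (single j j (givensRotation c s₁ s₂ 1 1 - 1))
  have h2 := norm_add_le (single i i (givensRotation c s₁ s₂ 0 0 - 1) +
    single i j (givensRotation c s₁ s₂ 0 1)) (single j i (givensRotation c s₁ s₂ 1 0))
  have h3 := norm_add_le (single i i (givensRotation c s₁ s₂ 0 0 - 1))
    (single i j (givensRotation c s₁ s₂ 0 1))
  rw [norm_single] at h1 h2
  rw [norm_single, norm_single] at h3
  simp only [givensRotation, of_apply, cons_val', cons_val_zero, cons_val_one,
    cons_val_fin_one] at h1 h2 h3 ⊢
  set N := ‖single i i ((c : ℂ) - 1) + single i j (-((s₁ : ℂ) + Complex.I * s₂)) +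
    single j i ((s₁ : ℂ) - Complex.I * s₂) + single j j ((c : ℂ) - 1)‖
  set x := ‖(s₁ : ℂ) - Complex.I * s₂‖
  set y := ‖-((s₁ : ℂ) + Complex.I * s₂)‖
  set w := ‖(c : ℂ) - 1‖
  have hN : N ≤ x + y + 2 * w := by linarith
  have hN0 : 0 ≤ N := norm_nonneg _
  nlinarith [sq_nonneg (x - y), sq_nonneg (x - w), sq_nonneg (y - w), mul_self_le_mul_self hN0 hN]

end Plane

/-! ### Column costs along plane rotations -/

namespace IsColumnCost

variable {n : ℕ} {f : Matrix (Fin n) (Fin n) ℂ → ℝ}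

theorem contDiff (hf : IsColumnCost f) : ContDiff ℝ ⊤ f := by
  obtain ⟨φ, hφ, -, -, hf⟩ := hf
  rw [funext hf]
  refine ContDiff.sum fun p _ => hφ.comp ?_
  let l : Matrix (Fin n) (Fin n) ℂ →ₗ[ℝ] (Fin n → ℂ) :=
    { toFun := fun U a => U a p
      map_add' := fun _ _ => rfl
      map_smul' := fun _ _ => rfl }
  exact l.toContinuousLinearMap.contDiff

theorem mul_diagonal (hf : IsColumnCost f) {z : Fin n → ℂ} (hz : ∀ i, ‖z i‖ = 1)
    (X : Matrix (Fin n) (Fin n) ℂ) : f (X * diagonal z) = f X := by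
  obtain ⟨φ, -, hφ, -, hf⟩ := hf
  rw [hf, hf]
  refine Finset.sum_congr rfl fun p _ => ?_
  refine Eq.trans (congrArg φ ?_) (hφ (z p) (hz p) _)
  funext a
  simp [mul_comm]

/-- Only the columns `i` and `j` move, each along a curve `cos τ x + sin τ y`. At `τ + π / 2` the
column `i` is `w` times the column `j` at `τ`, and the column `j` is `-star w` times the column `i`
at `τ`, where `w = a - i b` has modulus one. So the sum over columns has period `π / 2`. -/
theorem exists_eq_cos_sin (hf : IsColumnCost f) (U : Matrix (Fin n) (Fin n) ℂ) {i j : Fin n}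
    (hij : i ≠ j) {a b : ℝ} (hab : a ^ 2 + b ^ 2 = 1) :
    ∃ A B C : ℝ, ∀ τ, f (U * planeRotation i j a b τ) =
      A + B * Real.cos (4 * τ) + C * Real.sin (4 * τ) := by
  obtain ⟨φ, -, hφ, htrig, hf⟩ := hf
  set w : ℂ := a - Complex.I * b with hw
  have hw' : -((a : ℂ) + Complex.I * b) = -star w := by
    rw [hw]; simp [sub_eq_add_neg]
  have hww : star w * w = 1 := by
    rw [hw]
    simp
    linear_combination (by exact_mod_cast hab : (a : ℂ) ^ 2 + (b : ℂ) ^ 2 = 1)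
      - (b : ℂ) ^ 2 * Complex.I_sq
  have hwn : ‖w‖ = 1 := by
    rw [RCLike.star_def, Complex.conj_mul'] at hww
    exact (pow_eq_one_iff_of_nonneg (norm_nonneg w) two_ne_zero).1 (by exact_mod_cast hww)
  set x : Fin n → Fin n → ℂ := fun p r => U r p
  set y : Fin n → Fin n → ℂ := fun p r =>
    if p = i then w * U r j else if p = j then -star w * U r i else 0
  have hcol : ∀ τ p, (fun r => (U * planeRotation i j a b τ) r p) =
      if p = i ∨ p = j then (Real.cos τ : ℂ) • x p + (Real.sin τ : ℂ) • y p else x p := by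
    intro τ p
    funext r
    rw [planeRotation, mul_planeTransformation_apply hij]
    by_cases hpi : p = i
    · subst hpi
      simp [x, y, givensRotation, hw]
      ring
    · by_cases hpj : p = j
      · subst hpj
        simp [x, y, givensRotation, hpi]
        rw [hw]
        simp
        ring
      · simp [hpi, hpj, x]
  refine IsTrig.eq_of_period ?_ fun τ => ?_
  · simp only [hf, hcol]
    push_cast
    refine IsTrig.sum _ _ fun p _ => ?_
    by_cases hp : p = i ∨ p = j
    · simpa only [if_pos hp, Complex.ofReal_cos, Complex.ofReal_sin] using htrig (x p) (y p)
    · simpa only [if_neg hp] using (IsTrig.const (φ (x p) : ℂ)).mono (Nat.zero_le 6)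
  · rw [hf, hf, ← Equiv.sum_comp (Equiv.swap i j)]
    refine Finset.sum_congr rfl fun p _ => ?_
    simp only [hcol, Real.cos_add_pi_div_two, Real.sin_add_pi_div_two]
    by_cases hpi : p = i
    · subst hpi
      rw [Equiv.swap_apply_left, if_pos (Or.inr rfl), if_pos (Or.inl rfl)]
      refine Eq.trans (congrArg φ ?_) (hφ (-star w) (by simpa using hwn) _)
      funext r
      simp [x, y, hij.symm]
      rw [RCLike.star_def] at hww
      linear_combination (Complex.sin τ * U r j) * hww
    · by_cases hpj : p = j
      · subst hpj
        rw [Equiv.swap_apply_right, if_pos (Or.inl rfl), if_pos (Or.inr rfl)]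
        refine Eq.trans (congrArg φ ?_) (hφ w hwn _)
        funext r
        simp [x, y, hpi]
        rw [RCLike.star_def] at hww
        linear_combination (Complex.sin τ * U r i) * hww
      · rw [Equiv.swap_apply_of_ne_of_ne hpi hpj, if_neg (by tauto), if_neg (by tauto)]

end IsColumnCost

/-! ### Derivatives and the Riemannian gradient -/

/-- The topology of the Frobenius norm. -/
noncomputable abbrev frobeniusTopology (n : ℕ) : TopologicalSpace (Matrix (Fin n) (Fin n) ℂ) :=
  Matrix.frobeniusNormedAddCommGroup.toMetricSpace.toUniformSpace.toTopologicalSpace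

attribute [local instance] frobeniusTopology

section Gradient

variable {n : ℕ} {f : Matrix (Fin n) (Fin n) ℂ → ℝ} {X : Matrix (Fin n) (Fin n) ℂ}

theorem hasDerivAt_comp_add_single (hf : DifferentiableAt ℝ f X) (i j : Fin n) (w : ℂ) :
    HasDerivAt (fun t : ℝ => f (X + single i j (t * w))) (fderiv ℝ f X (single i j w)) 0 := by
  have h : HasDerivAt (fun t : ℝ => X + t • single i j w) (single i j w) 0 := by
    have := ((hasDerivAt_id (0 : ℝ)).smul_const (single i j w)).const_add X
    rwa [one_smul] at this
  have hf' : HasFDerivAt f (fderiv ℝ f X) (X + (0 : ℝ) • single i j w) := by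
    simpa using hf.hasFDerivAt
  have hc := hf'.comp_hasDerivAt (0 : ℝ) h
  simpa only [Function.comp_def, smul_single, Complex.real_smul] using hc

theorem euclideanGradient_apply (hf : DifferentiableAt ℝ f X) (i j : Fin n) :
    euclideanGradient f X i j = (fderiv ℝ f X (single i j 1) : ℂ) +
      Complex.I * (fderiv ℝ f X (single i j Complex.I) : ℂ) := by
  have h1 := (hasDerivAt_comp_add_single hf i j 1).deriv
  have h2 := (hasDerivAt_comp_add_single hf i j Complex.I).deriv
  simp only [mul_one] at h1
  rw [euclideanGradient, of_apply, h1, h2]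

theorem fderiv_eq_re_trace (hf : DifferentiableAt ℝ f X) (Y : Matrix (Fin n) (Fin n) ℂ) :
    fderiv ℝ f X Y = ((euclideanGradient f X)ᴴ * Y).trace.re := by
  have hY : Y = ∑ i, ∑ j, ((Y i j).re • single i j (1 : ℂ) + (Y i j).im • single i j Complex.I) := by
    conv_lhs => rw [matrix_eq_sum_single Y]
    refine Finset.sum_congr rfl fun i _ => Finset.sum_congr rfl fun j _ => ?_
    rw [smul_single, smul_single, ← single_add]
    congr 1
    simp [Complex.re_add_im]
  conv_lhs => rw [hY]
  simp only [map_sum, map_add, map_smul, Matrix.trace, diag_apply, Matrix.mul_apply,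
    conjTranspose_apply, Complex.re_sum]
  rw [Finset.sum_comm]
  refine Finset.sum_congr rfl fun i _ => Finset.sum_congr rfl fun j _ => ?_
  rw [euclideanGradient_apply hf]
  simp
  ring

/-- Paired with a skew-Hermitian `Z`, the Hermitian part of `Uᴴ ∇f` contributes nothing, and the
skew part is the gradient. The factor `n` comes from the crude bound of a trace by the norm. -/
theorem abs_fderiv_le_riemannianGradient {U Z : Matrix (Fin n) (Fin n) ℂ}
    (hf : DifferentiableAt ℝ f U) (hU : U ∈ unitaryGroup (Fin n) ℂ) (hZ : Zᴴ = -Z) :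
    |fderiv ℝ f U (U * Z)| ≤ n * (‖riemannianGradient f U‖ * ‖Z‖) := by
  rw [riemannianGradient, norm_unitary_mul hU, fderiv_eq_re_trace hf]
  set M := Uᴴ * euclideanGradient f U with hM
  have hM' : (euclideanGradient f U)ᴴ * U = Mᴴ := by simp [hM]
  rw [hM', ← mul_assoc, hM']
  have h1 : (M * Z).trace.re = -(Mᴴ * Z).trace.re := by
    have h : star (M * Z).trace = -(Mᴴ * Z).trace := by
      rw [← trace_conjTranspose, conjTranspose_mul, hZ, neg_mul, trace_neg, trace_mul_comm]
    have h' := congrArg Complex.re h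
    simpa using h'
  have h2 : (Mᴴ * Z).trace.re = (((1 / 2 : ℂ) • (M - Mᴴ))ᴴ * Z).trace.re := by
    simp only [conjTranspose_smul, conjTranspose_sub, conjTranspose_conjTranspose, smul_mul_assoc,
      sub_mul, trace_smul, trace_sub, smul_eq_mul]
    have : star (1 / 2 : ℂ) = ((1 / 2 : ℝ) : ℂ) := by
      rw [RCLike.star_def, ← Complex.conj_ofReal]; norm_num
    rw [this, Complex.re_ofReal_mul, Complex.sub_re, h1]
    ring
  rw [h2]
  refine (Complex.abs_re_le_norm _).trans ((norm_trace_le _).trans ?_)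
  gcongr
  refine (frobenius_norm_mul _ _).trans ?_
  rw [frobenius_norm_conjTranspose]

/-- The vanishing derivatives in the phase directions kill the diagonal of the skew-Hermitian
gradient. Its two remaining entries have equal modulus, and the two derivatives on the right are
twice their real and imaginary parts up to sign. -/
theorem norm_riemannianGradient_one_sq {h : Matrix (Fin 2) (Fin 2) ℂ → ℝ}
    (hh : DifferentiableAt ℝ h 1) (h0 : fderiv ℝ h 1 (single 0 0 Complex.I) = 0)
    (h1 : fderiv ℝ h 1 (single 1 1 Complex.I) = 0) :
    2 * ‖riemannianGradient h 1‖ ^ 2 = fderiv ℝ h 1 (single 1 0 1 - single 0 1 1) ^ 2 +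
      fderiv ℝ h 1 (single 1 0 Complex.I + single 0 1 Complex.I) ^ 2 := by
  rw [riemannianGradient, frobenius_norm_sq]
  simp only [Fin.sum_univ_two, one_mul, conjTranspose_one, mul_one, Matrix.smul_apply,
    Matrix.sub_apply, conjTranspose_apply, euclideanGradient_apply hh, map_sub, map_add, h0, h1,
    Complex.sq_norm, Complex.normSq_apply]
  simp
  ring

end Gradient

/-! ### The restriction to a pair of columns and the gain of a Jacobi step -/

section Restriction

variable {n : ℕ} {f : Matrix (Fin n) (Fin n) ℂ → ℝ} {i j : Fin n}

theorem planeTransformation_diagonal (hij : i ≠ j) (z : Fin 2 → ℂ) :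
    planeTransformation i j (diagonal z) =
      diagonal fun a => if a = i then z 0 else if a = j then z 1 else 1 := by
  ext a b
  rw [← one_mul (planeTransformation i j (diagonal z)), mul_planeTransformation_apply hij]
  by_cases hbi : b = i
  · subst hbi
    by_cases hab : a = b
    · subst hab; simp
    · simp [hab]
  · by_cases hbj : b = j
    · subst hbj
      by_cases hab : a = b
      · subst hab; simp [hbi]
      · simp [hab, hbi]
    · by_cases hab : a = b
      · subst hab; simp [hbi, hbj]
      · simp [hab, hbi, hbj]

theorem IsColumnCost.contDiff_restriction (hf : IsColumnCost f) (hij : i ≠ j)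
    (U : Matrix (Fin n) (Fin n) ℂ) : ContDiff ℝ ⊤ (restriction f i j U) := by
  refine hf.contDiff.comp ?_
  let l : Matrix (Fin 2) (Fin 2) ℂ →ₗ[ℝ] Matrix (Fin n) (Fin n) ℂ :=
    { toFun := fun Ψ => U * (single i i (Ψ 0 0) + single i j (Ψ 0 1) +
        single j i (Ψ 1 0) + single j j (Ψ 1 1))
      map_add' := fun Ψ Φ => by
        simp only [Matrix.add_apply, single_add, ← mul_add]
        congr 1
        abel
      map_smul' := fun r Ψ => by
        simp only [Matrix.smul_apply, ← smul_single, ← smul_add, mul_smul_comm, RingHom.id_apply] }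
  have : (fun Ψ => U * planeTransformation i j Ψ) =
      fun Ψ => U * (1 - single i i 1 - single j j 1) + l.toContinuousLinearMap Ψ := by
    funext Ψ
    simp only [LinearMap.coe_toContinuousLinearMap', LinearMap.coe_mk, AddHom.coe_mk, l,
      planeTransformation_eq hij, sub_eq_add_neg, single_add, single_neg, ← mul_add]
    congr 1
    abel
  rw [this]
  exact contDiff_const.add l.toContinuousLinearMap.contDiff

/-- The direction is the velocity of a curve that only changes the phase of one column, and `f` is
constant along that curve. -/
theorem IsColumnCost.fderiv_restriction_single (hf : IsColumnCost f) (hij : i ≠ j)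
    (U : Matrix (Fin n) (Fin n) ℂ) (k : Fin 2) :
    fderiv ℝ (restriction f i j U) 1 (single k k Complex.I) = 0 := by
  have hd : DifferentiableAt ℝ (restriction f i j U) 1 :=
    (hf.contDiff_restriction hij U).differentiable (by simp) 1
  let l : ℂ →ₗ[ℝ] Matrix (Fin 2) (Fin 2) ℂ := singleLinearMap ℝ k k
  have hexp : HasDerivAt (fun t : ℝ => Complex.exp (t * Complex.I) - 1) Complex.I 0 := by
    have := (((hasDerivAt_id (0 : ℝ)).ofReal_comp.mul_const Complex.I).cexp).sub_const 1
    simpa using this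
  have hc : HasDerivAt (fun t : ℝ => 1 + l.toContinuousLinearMap (Complex.exp (t * Complex.I) - 1))
      (l.toContinuousLinearMap Complex.I) 0 :=
    (l.toContinuousLinearMap.hasFDerivAt.comp_hasDerivAt 0 hexp).const_add _
  have hf' : HasFDerivAt (restriction f i j U) (fderiv ℝ (restriction f i j U) 1)
      (1 + l.toContinuousLinearMap (Complex.exp ((0 : ℝ) * Complex.I) - 1)) := by
    simpa using hd.hasFDerivAt
  have h := hf'.comp_hasDerivAt 0 hc
  have hconst : (restriction f i j U ∘ fun t : ℝ =>
      1 + l.toContinuousLinearMap (Complex.exp (t * Complex.I) - 1)) = fun _ => f U := by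
    funext t
    have hdiag : (1 : Matrix (Fin 2) (Fin 2) ℂ) +
        l.toContinuousLinearMap (Complex.exp (t * Complex.I) - 1) =
        diagonal (Function.update 1 k (Complex.exp (t * Complex.I))) := by
      ext a b
      fin_cases k <;> fin_cases a <;> fin_cases b <;> simp [l]
    simp only [Function.comp_apply, hdiag, restriction, planeTransformation_diagonal hij]
    apply hf.mul_diagonal
    intro a
    fin_cases k <;> simp <;> split_ifs <;> simp [Complex.norm_exp_ofReal_mul_I]
  rw [hconst] at h
  exact h.unique (hasDerivAt_const 0 _)

theorem IsColumnCost.hasDerivAt_planeRotation (hf : IsColumnCost f) (hij : i ≠ j)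
    (U : Matrix (Fin n) (Fin n) ℂ) (a b : ℝ) :
    HasDerivAt (fun τ => f (U * planeRotation i j a b τ))
      (a * fderiv ℝ (restriction f i j U) 1 (single 1 0 1 - single 0 1 1) -
        b * fderiv ℝ (restriction f i j U) 1 (single 1 0 Complex.I + single 0 1 Complex.I)) 0 := by
  have hd : DifferentiableAt ℝ (restriction f i j U) 1 :=
    (hf.contDiff_restriction hij U).differentiable (by simp) 1
  set K : Matrix (Fin 2) (Fin 2) ℂ := a • (single 1 0 1 - single 0 1 1) -
    b • (single 1 0 Complex.I + single 0 1 Complex.I) with hK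
  have hc : HasDerivAt (fun τ : ℝ => Real.cos τ • (1 : Matrix (Fin 2) (Fin 2) ℂ) + Real.sin τ • K)
      K 0 := by
    have := ((Real.hasDerivAt_cos 0).smul_const (1 : Matrix (Fin 2) (Fin 2) ℂ)).add
      ((Real.hasDerivAt_sin 0).smul_const K)
    rwa [Real.sin_zero, neg_zero, zero_smul, zero_add, Real.cos_zero, one_smul] at this
  have hf' : HasFDerivAt (restriction f i j U) (fderiv ℝ (restriction f i j U) 1)
      (Real.cos 0 • (1 : Matrix (Fin 2) (Fin 2) ℂ) + Real.sin 0 • K) := by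
    simpa using hd.hasFDerivAt
  have h := hf'.comp_hasDerivAt 0 hc
  have hcurve : (restriction f i j U ∘ fun τ : ℝ =>
      Real.cos τ • (1 : Matrix (Fin 2) (Fin 2) ℂ) + Real.sin τ • K) =
      fun τ => f (U * planeRotation i j a b τ) := by
    funext τ
    simp only [Function.comp_apply, restriction, planeRotation]
    congr 3
    ext p q
    fin_cases p <;> fin_cases q <;> simp [givensRotation, hK] <;> ring
  rw [hcurve] at h
  refine h.congr_deriv ?_
  rw [hK, map_sub, map_smul, map_smul, smul_eq_mul, smul_eq_mul]

theorem exists_eq_sqrt_mul_cos_sin (x y : ℝ) :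
    ∃ θ : ℝ, x = √(x ^ 2 + y ^ 2) * Real.cos θ ∧ y = √(x ^ 2 + y ^ 2) * Real.sin θ := by
  have h : ‖(⟨x, y⟩ : ℂ)‖ = √(x ^ 2 + y ^ 2) := by
    rw [Complex.norm_def, Complex.normSq_mk, sq, sq]
  exact ⟨Complex.arg ⟨x, y⟩, by rw [← h, Complex.norm_mul_cos_arg],
    by rw [← h, Complex.norm_mul_sin_arg]⟩

theorem hasDerivAt_cos_sin (A B C : ℝ) :
    HasDerivAt (fun τ : ℝ => A + B * Real.cos (4 * τ) + C * Real.sin (4 * τ)) (4 * C) 0 := by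
  have h4 : HasDerivAt (fun τ : ℝ => 4 * τ) 4 0 := by
    simpa using (hasDerivAt_id (0 : ℝ)).const_mul 4
  have := ((h4.cos.const_mul B).const_add A).add (h4.sin.const_mul C)
  rw [mul_zero, Real.sin_zero, Real.cos_zero] at this
  refine this.congr_deriv ?_
  ring

/-- In the plane of the pair `(i, j)` there is a direction that realizes the gradient of the
restriction. -/
theorem IsColumnCost.exists_direction (hf : IsColumnCost f) (hij : i ≠ j)
    (U : Matrix (Fin n) (Fin n) ℂ) :
    ∃ a b A B C : ℝ, a ^ 2 + b ^ 2 = 1 ∧ (∀ τ, f (U * planeRotation i j a b τ) =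
      A + B * Real.cos (4 * τ) + C * Real.sin (4 * τ)) ∧
      8 * C ^ 2 = ‖riemannianGradient (restriction f i j U) 1‖ ^ 2 := by
  have hd : DifferentiableAt ℝ (restriction f i j U) 1 :=
    (hf.contDiff_restriction hij U).differentiable (by simp) 1
  have hg := norm_riemannianGradient_one_sq hd (hf.fderiv_restriction_single hij U 0)
    (hf.fderiv_restriction_single hij U 1)
  have hder := hf.hasDerivAt_planeRotation hij U
  set x := fderiv ℝ (restriction f i j U) 1 (single 1 0 1 - single 0 1 1)
  set y := fderiv ℝ (restriction f i j U) 1 (single 1 0 Complex.I + single 0 1 Complex.I)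
  obtain ⟨θ, hx, hy⟩ := exists_eq_sqrt_mul_cos_sin x y
  have hab : Real.cos θ ^ 2 + (-Real.sin θ) ^ 2 = 1 := by
    rw [neg_sq, Real.cos_sq_add_sin_sq]
  obtain ⟨A, B, C, hABC⟩ := hf.exists_eq_cos_sin U hij hab
  refine ⟨_, _, A, B, C, hab, hABC, ?_⟩
  have h := hder (Real.cos θ) (-Real.sin θ)
  rw [funext hABC] at h
  have hC := h.unique (hasDerivAt_cos_sin A B C)
  have hs : √(x ^ 2 + y ^ 2) ^ 2 = x ^ 2 + y ^ 2 := Real.sq_sqrt (by positivity)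
  -- The direction `(cos θ, -sin θ)` is aligned with `(x, y)`, so the derivative `4C` at zero is the
  -- full length. With `2 ‖grad h‖² = x² + y² = 16 C²` this gives the factor `8`.
  have : √(x ^ 2 + y ^ 2) = 4 * C := by
    linear_combination hC - Real.cos θ * hx - Real.sin θ * hy - √(x ^ 2 + y ^ 2) * hab
  rw [this] at hs
  linarith

/-- Along the direction of the gradient, `f` has amplitude `ρ = √(B² + C²)`, and the Jacobi rotation
gains at least `ρ - B`. The oscillation `2ρ` is at most `2R`, so `C² = (ρ - B)(ρ + B) ≤ 2R (ρ - B)`;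
multiply by `8`. -/
theorem IsColumnCost.norm_gradient_restriction_sq_le (hf : IsColumnCost f) (hij : i < j)
    {U : Matrix (Fin n) (Fin n) ℂ} (hU : U ∈ unitaryGroup (Fin n) ℂ) {R : ℝ}
    (hR : ∀ V ∈ unitaryGroup (Fin n) ℂ, |f V| ≤ R) {Ψ : Matrix (Fin 2) (Fin 2) ℂ}
    (hΨ : IsJacobiRotation (restriction f i j U) Ψ) :
    ‖riemannianGradient (restriction f i j U) 1‖ ^ 2 ≤
      16 * R * (f (U * planeTransformation i j Ψ) - f U) := by
  obtain ⟨a, b, A, B, C, hab, hABC, hC⟩ := hf.exists_direction hij.ne U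
  obtain ⟨θ, hB, hC'⟩ := exists_eq_sqrt_mul_cos_sin B C
  set ρ := √(B ^ 2 + C ^ 2) with hρ
  have hρ2 : ρ ^ 2 = B ^ 2 + C ^ 2 := Real.sq_sqrt (by positivity)
  have hρ0 : 0 ≤ ρ := Real.sqrt_nonneg _
  have hle : ∀ τ, f (U * planeRotation i j a b τ) ≤ f (U * planeTransformation i j Ψ) := fun τ =>
    hΨ.2 _ (givensRotation_mem_unitaryGroup
      (by linear_combination Real.cos_sq_add_sin_sq τ + Real.sin τ ^ 2 * hab))
  have h0 := hABC 0
  rw [planeRotation_zero hij.ne, mul_one] at h0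
  -- At `θ / 4` the sinusoid takes its maximum `A + ρ`, and a quarter of `π` later its minimum `A -
  -- ρ`.
  have h1 := hABC (θ / 4)
  have h2 := hABC (θ / 4 + Real.pi / 4)
  rw [show 4 * (θ / 4) = θ by ring] at h1
  rw [show 4 * (θ / 4 + Real.pi / 4) = θ + Real.pi by ring, Real.cos_add_pi, Real.sin_add_pi] at h2
  simp only [mul_zero, Real.cos_zero, Real.sin_zero] at h0
  have hmem : ∀ τ, U * planeRotation i j a b τ ∈ unitaryGroup (Fin n) ℂ := fun τ =>
    mul_mem hU (planeRotation_mem_unitaryGroup hij.ne hab τ)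
  have e1 : B * Real.cos θ + C * Real.sin θ = ρ := by
    rw [hB, hC']
    linear_combination ρ * Real.cos_sq_add_sin_sq θ
  have b1 := abs_le.1 (hR _ (hmem (θ / 4)))
  have b2 := abs_le.1 (hR _ (hmem (θ / 4 + Real.pi / 4)))
  have hρR : ρ ≤ R := by linarith
  have hg := hle (θ / 4)
  have hBρ : |B| ≤ ρ := abs_le_of_sq_le_sq (by nlinarith [sq_nonneg C]) hρ0
  have := abs_le.1 hBρ
  nlinarith

end Restriction

attribute [local instance] Matrix.frobeniusNormedRing Matrix.frobeniusNormedAlgebra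

/-! ### Second-order expansions and semidefinite forms -/

section Taylor

variable {E : Type*} [NormedAddCommGroup E] [NormedSpace ℝ E] {F : E → ℝ}

theorem eventually_norm_fderiv_sub_le (hF : ContDiff ℝ 2 F) {ε : ℝ} (hε : 0 < ε) :
    ∀ᶠ X in 𝓝 (0 : E),
      ‖fderiv ℝ F X - fderiv ℝ F 0 - fderiv ℝ (fderiv ℝ F) 0 X‖ ≤ ε * ‖X‖ := by
  have h : DifferentiableAt ℝ (fderiv ℝ F) 0 :=
    (hF.fderiv_right (m := 1) (by norm_num)).differentiable (by norm_num) 0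
  have h' := (hasFDerivAt_iff_isLittleO_nhds_zero.1 h.hasFDerivAt).def hε
  simpa using h'

theorem eventually_abs_sub_taylor_le (hF : ContDiff ℝ 2 F) {ε : ℝ} (hε : 0 < ε) :
    ∀ᶠ X in 𝓝 (0 : E),
      |F X - F 0 - fderiv ℝ F 0 X - 1 / 2 * fderiv ℝ (fderiv ℝ F) 0 X X| ≤ ε * ‖X‖ ^ 2 := by
  set B := fderiv ℝ (fderiv ℝ F) 0 with hB
  have hsymm : ∀ X Y, B X Y = B Y X :=
    fun X Y => (hF.contDiffAt (x := 0)).isSymmSndFDerivAt (by simp) X Y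
  obtain ⟨r, hr, h⟩ := Metric.eventually_nhds_iff.1 (eventually_norm_fderiv_sub_le hF hε)
  refine Metric.eventually_nhds_iff.2 ⟨r, hr, fun X hX => ?_⟩
  have hder : ∀ Y : E, HasFDerivAt
      (fun Y => F Y - F 0 - fderiv ℝ F 0 Y - 1 / 2 * B Y Y) (fderiv ℝ F Y - fderiv ℝ F 0 - B Y) Y := by
    intro Y
    have h1 := (hF.differentiable (by norm_num) Y).hasFDerivAt
    have h2 : HasFDerivAt (fun Y => B Y Y) (B Y + B.flip Y) Y := by
      have := B.hasFDerivAt (x := Y) |>.clm_apply (hasFDerivAt_id Y)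
      refine this.congr_fderiv ?_
      ext Z
      simp
    refine (((h1.sub_const (F 0)).sub (fderiv ℝ F 0).hasFDerivAt).sub
      (h2.const_mul (1 / 2))).congr_fderiv ?_
    ext Z
    simp [hsymm Z Y]
    ring
  -- The mean value inequality is applied to the Taylor remainder on the ball of radius `‖X‖`, where
  -- its derivative is at most `ε ‖X‖`.
  have hmv := (convex_closedBall (0 : E) ‖X‖).norm_image_sub_le_of_norm_hasFDerivWithin_le
    (C := ε * ‖X‖) (x := 0) (y := X) (fun Y _ => (hder Y).hasFDerivWithinAt) (fun Y hY => ?_)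
    (by simp) (by simp)
  · simpa [sq, mul_assoc] using hmv
  · rw [mem_closedBall_zero_iff] at hY
    have hd : dist Y 0 < r := by
      rw [dist_zero_right] at hX ⊢
      exact hY.trans_lt hX
    exact (h hd).trans (by gcongr)

theorem eventually_abs_fderiv_self_sub_le (hF : ContDiff ℝ 2 F) {ε : ℝ} (hε : 0 < ε) :
    ∀ᶠ X in 𝓝 (0 : E),
      |fderiv ℝ F X X - fderiv ℝ F 0 X - fderiv ℝ (fderiv ℝ F) 0 X X| ≤ ε * ‖X‖ ^ 2 := by
  filter_upwards [eventually_norm_fderiv_sub_le hF hε] with X hX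
  have h := ((fderiv ℝ F X - fderiv ℝ F 0 - fderiv ℝ (fderiv ℝ F) 0 X).le_opNorm X).trans
    (mul_le_mul_of_nonneg_right hX (norm_nonneg X))
  rwa [_root_.sub_apply, _root_.sub_apply, Real.norm_eq_abs, mul_assoc, ← sq] at h

theorem exists_abs_apply_self_le (B : E →L[ℝ] E →L[ℝ] ℝ) :
    ∃ K ≥ 0, ∀ X, |B X X| ≤ K * ‖X‖ ^ 2 := by
  refine ⟨‖B‖, norm_nonneg B, fun X => ?_⟩
  have := B.le_opNorm₂ X X
  rwa [mul_assoc, ← sq] at this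

theorem tendsto_second_difference (hF : ContDiff ℝ 2 F) (h0 : fderiv ℝ F 0 = 0) (X : E) :
    Filter.Tendsto (fun t : ℝ => (F (t • X) - F 0) / t ^ 2) (𝓝[≠] 0)
      (𝓝 (1 / 2 * fderiv ℝ (fderiv ℝ F) 0 X X)) := by
  refine Metric.tendsto_nhds.2 fun ε hε => ?_
  have hpos : 0 < ‖X‖ ^ 2 + 1 := by positivity
  have hc : Filter.Tendsto (fun t : ℝ => t • X) (𝓝[≠] 0) (𝓝 0) := by
    have : Continuous fun t : ℝ => t • X := by fun_prop
    simpa using (this.tendsto 0).mono_left nhdsWithin_le_nhds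
  filter_upwards [hc.eventually (eventually_abs_sub_taylor_le hF (ε := ε / (‖X‖ ^ 2 + 1))
    (by positivity)), self_mem_nhdsWithin] with t ht ht0
  have ht0 : t ≠ 0 := ht0
  rw [h0] at ht
  simp only [map_smul, smul_eq_mul, _root_.zero_apply, mul_zero, sub_zero, norm_smul,
    _root_.smul_apply, Real.norm_eq_abs, mul_pow, sq_abs] at ht
  rw [Real.dist_eq]
  have ht2 : 0 < t ^ 2 := by positivity
  have e : (F (t • X) - F 0) / t ^ 2 - 1 / 2 * fderiv ℝ (fderiv ℝ F) 0 X X =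
      (F (t • X) - F 0 - 1 / 2 * (t * (t * fderiv ℝ (fderiv ℝ F) 0 X X))) / t ^ 2 := by
    field_simp
  rw [e, abs_div, abs_of_pos ht2, div_lt_iff₀ ht2]
  refine ht.trans_lt ?_
  rw [div_mul_eq_mul_div, div_lt_iff₀ hpos]
  nlinarith [mul_pos hε ht2]

theorem eq_zero_of_nonpos_of_symm {B : E →L[ℝ] E →L[ℝ] ℝ} (hs : ∀ X Y, B X Y = B Y X)
    (hB : ∀ X, B X X ≤ 0) {X : E} (hX : B X X = 0) : B X = 0 := by
  ext Y
  by_contra hne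
  have hne : B X Y ≠ 0 := hne
  -- If `B X Y` were nonzero, adding this multiple of the null vector `X` to `Y` would raise the
  -- value of the form to `1`.
  have h := hB (Y + ((1 - B Y Y) / (2 * B X Y)) • X)
  simp only [map_add, map_smul, _root_.add_apply, _root_.smul_apply,
    smul_eq_mul, hX, hs Y X] at h
  have e : (1 - B Y Y) / (2 * B X Y) * B X Y = (1 - B Y Y) / 2 := by
    field_simp
  rw [e] at h
  linarith

end Taylor

/-! ### The tangent space and the exponential map -/

section TangentSpace

variable {n : ℕ} {U : Matrix (Fin n) (Fin n) ℂ} {f : Matrix (Fin n) (Fin n) ℂ → ℝ}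

theorem expMap_eq (U X : Matrix (Fin n) (Fin n) ℂ) : expMap U X = U * NormedSpace.exp (Uᴴ * X) :=
  rfl

theorem mem_tangentSpace {X : Matrix (Fin n) (Fin n) ℂ} :
    X ∈ tangentSpace U ↔ (Uᴴ * X)ᴴ = -(Uᴴ * X) := by
  rw [conjTranspose_mul, conjTranspose_conjTranspose, eq_neg_iff_add_eq_zero]
  rfl

theorem conjTranspose_mul_self (hU : U ∈ unitaryGroup (Fin n) ℂ) : Uᴴ * U = 1 :=
  mem_unitaryGroup_iff'.1 hU

theorem self_mul_conjTranspose (hU : U ∈ unitaryGroup (Fin n) ℂ) : U * Uᴴ = 1 :=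
  mem_unitaryGroup_iff.1 hU

theorem mul_mem_tangentSpace (hU : U ∈ unitaryGroup (Fin n) ℂ) {Z : Matrix (Fin n) (Fin n) ℂ}
    (hZ : Zᴴ = -Z) : U * Z ∈ tangentSpace U := by
  rw [mem_tangentSpace, ← mul_assoc, conjTranspose_mul_self hU, one_mul, hZ]

theorem expMap_mem_unitaryGroup (hU : U ∈ unitaryGroup (Fin n) ℂ) (X : tangentSpace U) :
    expMap U X ∈ unitaryGroup (Fin n) ℂ := by
  rw [expMap_eq]
  let : NormedAlgebra ℚ (Matrix (Fin n) (Fin n) ℂ) := NormedAlgebra.restrictScalars ℚ ℝ _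
  have : ContinuousStar (Matrix (Fin n) (Fin n) ℂ) := ⟨continuous_id.matrix_conjTranspose⟩
  exact mul_mem hU (NormedSpace.exp_mem_unitary_of_mem_skewAdjoint
    (skewAdjoint.mem_iff.2 (mem_tangentSpace.1 X.2)))

theorem contDiff_exp :
    ContDiff ℝ ⊤ (NormedSpace.exp : Matrix (Fin n) (Fin n) ℂ → Matrix (Fin n) (Fin n) ℂ) := by
  have h : AnalyticOnNhd ℝ
      (NormedSpace.exp : Matrix (Fin n) (Fin n) ℂ → Matrix (Fin n) (Fin n) ℂ) Set.univ :=
    fun x _ => NormedSpace.exp_analytic x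
  exact contDiff_omega_iff_analyticOnNhd.2 h

theorem contDiff_comp_expMap (hf : ContDiff ℝ ⊤ f) :
    ContDiff ℝ ⊤ fun X : tangentSpace U => f (expMap U X) := by
  refine hf.comp ?_
  have h1 : ContDiff ℝ ⊤ fun X : tangentSpace U => Uᴴ * (X : Matrix (Fin n) (Fin n) ℂ) :=
    contDiff_const.mul (tangentSpace U).subtypeL.contDiff
  exact contDiff_const.mul (contDiff_exp.comp h1)

theorem expMap_zero (U : Matrix (Fin n) (Fin n) ℂ) : expMap U 0 = U := by
  rw [expMap_eq, mul_zero, NormedSpace.exp_zero, mul_one]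

/-- The Riemannian Hessian with respect to the topology of the Frobenius norm. -/
noncomputable def hessian (f : Matrix (Fin n) (Fin n) ℂ → ℝ) (U : Matrix (Fin n) (Fin n) ℂ) :
    tangentSpace U →L[ℝ] tangentSpace U →L[ℝ] ℝ :=
  fderiv ℝ (fderiv ℝ fun X : tangentSpace U => f (expMap U X)) 0

/-- This passes the rank hypothesis to the Hessian formed with the Frobenius topology; the two sides
agree by definition. -/
theorem hessianRank_eq (f : Matrix (Fin n) (Fin n) ℂ → ℝ) (U : Matrix (Fin n) (Fin n) ℂ) :
    hessianRank f U = Module.finrank ℝ (LinearMap.range (hessian f U).toLinearMap) :=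
  rfl

/-- A skew-Hermitian matrix is determined by the real parts of its entries above the diagonal and
the imaginary parts of the others, `n²` real numbers in all. -/
theorem finrank_tangentSpace_le (hU : U ∈ unitaryGroup (Fin n) ℂ) :
    Module.finrank ℝ (tangentSpace U) ≤ n * n := by
  let J : tangentSpace U →ₗ[ℝ] (Fin n × Fin n → ℝ) :=
    { toFun := fun X p => if p.1 < p.2 then ((Uᴴ * (X : Matrix (Fin n) (Fin n) ℂ)) p.1 p.2).re
        else ((Uᴴ * (X : Matrix (Fin n) (Fin n) ℂ)) p.1 p.2).im
      map_add' := fun X Y => by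
        funext p
        simp only [Submodule.coe_add, mul_add, Matrix.add_apply, Complex.add_re, Complex.add_im,
          Pi.add_apply]
        split_ifs <;> rfl
      map_smul' := fun r X => by
        funext p
        simp only [Submodule.coe_smul, mul_smul_comm, Matrix.smul_apply, Complex.smul_re,
          Complex.smul_im, Pi.smul_apply, RingHom.id_apply]
        split_ifs <;> rfl }
  have hJ : Function.Injective J := by
    rw [← LinearMap.ker_eq_bot, LinearMap.ker_eq_bot']
    intro X hX
    have hs := mem_tangentSpace.1 X.2
    set Z := Uᴴ * (X : Matrix (Fin n) (Fin n) ℂ) with hZ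
    have hJ' : ∀ a b, (if a < b then (Z a b).re else (Z a b).im) = 0 :=
      fun a b => congrFun hX (a, b)
    have hre : ∀ a b, (Z a b).re = -(Z b a).re := fun a b => by
      have := congrArg Complex.re (congrFun (congrFun hs b) a)
      simpa using this
    have him : ∀ a b, (Z a b).im = (Z b a).im := fun a b => by
      have := congrArg Complex.im (congrFun (congrFun hs b) a)
      simpa using this
    have hZ0 : Z = 0 := by
      ext a b
      rcases lt_trichotomy a b with h | h | h
      · have h1 := hJ' a b
        have h2 := hJ' b a
        rw [if_pos h] at h1
        rw [if_neg h.not_gt] at h2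
        exact Complex.ext h1 ((him a b).trans h2)
      · subst h
        have h1 := hJ' a a
        rw [if_neg (lt_irrefl a)] at h1
        exact Complex.ext (by have := hre a a; simp; linarith) h1
      · have h1 := hJ' a b
        have h2 := hJ' b a
        rw [if_neg h.not_gt] at h1
        rw [if_pos h] at h2
        exact Complex.ext (by rw [hre a b, h2]; simp) h1
    have : (X : Matrix (Fin n) (Fin n) ℂ) = 0 := by
      rw [← one_mul (X : Matrix (Fin n) (Fin n) ℂ), ← self_mul_conjTranspose hU, mul_assoc, ← hZ,
        hZ0, mul_zero]
    exact Subtype.ext this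
  simpa using LinearMap.finrank_le_finrank_of_injective hJ

/-- The tangent vectors `U D` with `D` diagonal. -/
noncomputable def diagonalTangent (hU : U ∈ unitaryGroup (Fin n) ℂ) :
    (Fin n → ℝ) →ₗ[ℝ] tangentSpace U where
  toFun x := ⟨U * diagonal fun p => (x p : ℂ) * Complex.I, mul_mem_tangentSpace hU (by
    rw [diagonal_conjTranspose, diagonal_neg]
    congr 1
    funext p
    simp)⟩
  map_add' x y := by
    ext1
    simp only [Submodule.coe_add, ← mul_add, diagonal_add, Pi.add_apply, Complex.ofReal_add,
      add_mul]
  map_smul' r x := by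
    ext1
    simp only [Submodule.coe_smul, ← mul_smul_comm, ← diagonal_smul, RingHom.id_apply]
    congr 2
    funext p
    simp [mul_assoc]

theorem diagonalTangent_injective (hU : U ∈ unitaryGroup (Fin n) ℂ) :
    Function.Injective (diagonalTangent hU) := by
  intro x y hxy
  have h : U * diagonal (fun p => (x p : ℂ) * Complex.I) =
      U * diagonal (fun p => (y p : ℂ) * Complex.I) := congrArg Subtype.val hxy
  have h' := congrArg (Uᴴ * ·) h
  simp only [← mul_assoc, conjTranspose_mul_self hU, one_mul] at h'
  funext p
  have := congrFun (diagonal_injective h') p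
  exact Complex.ofReal_injective (mul_right_cancel₀ Complex.I_ne_zero this)

theorem expMap_diagonalTangent (hU : U ∈ unitaryGroup (Fin n) ℂ) (x : Fin n → ℝ) :
    expMap U (diagonalTangent hU x) =
      U * diagonal fun p => Complex.exp ((x p : ℂ) * Complex.I) := by
  have h : Uᴴ * (diagonalTangent hU x : Matrix (Fin n) (Fin n) ℂ) =
      diagonal fun p => (x p : ℂ) * Complex.I := by
    change Uᴴ * (U * diagonal fun p => (x p : ℂ) * Complex.I) = _
    rw [← mul_assoc, conjTranspose_mul_self hU, one_mul]
  rw [expMap, h, Matrix.exp_diagonal]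
  congr 2
  funext p
  rw [Pi.coe_exp, Complex.exp_eq_exp_ℂ]

end TangentSpace

/-! ### The Hessian at a semi-strict local maximum -/

section Hessian

variable {n : ℕ} {U : Matrix (Fin n) (Fin n) ℂ} {f : Matrix (Fin n) (Fin n) ℂ → ℝ}

theorem hessian_symm (hf : ContDiff ℝ ⊤ f) (X Y : tangentSpace U) :
    hessian f U X Y = hessian f U Y X :=
  ((contDiff_comp_expMap (U := U) hf).contDiffAt (x := 0)).isSymmSndFDerivAt (by simp) X Y

/-- `U` maximizes `f` among the unitary matrices close to it. -/
def IsMaxNear (f : Matrix (Fin n) (Fin n) ℂ → ℝ) (U : Matrix (Fin n) (Fin n) ℂ) : Prop :=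
  ∃ r > 0, ∀ V ∈ unitaryGroup (Fin n) ℂ, ‖V - U‖ < r → f V ≤ f U

theorem IsMaxNear.isLocalMax (hmax : IsMaxNear f U) (hU : U ∈ unitaryGroup (Fin n) ℂ) :
    IsLocalMax (fun X : tangentSpace U => f (expMap U X)) 0 := by
  obtain ⟨r, hr, h⟩ := hmax
  have hc : Continuous fun X : tangentSpace U => expMap U X := by
    have h1 : Continuous fun X : tangentSpace U => Uᴴ * (X : Matrix (Fin n) (Fin n) ℂ) :=
      continuous_const.mul continuous_subtype_val
    exact continuous_const.mul (contDiff_exp.continuous.comp h1)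
  have h0 : expMap U ((0 : tangentSpace U) : Matrix (Fin n) (Fin n) ℂ) = U := expMap_zero U
  have : ∀ᶠ X : tangentSpace U in 𝓝 0, ‖expMap U X - U‖ < r := by
    have hc' : Continuous fun X : tangentSpace U => ‖expMap U X - U‖ :=
      (hc.sub continuous_const).norm
    exact hc'.continuousAt.eventually_lt continuousAt_const (by rw [h0]; simpa using hr)
  filter_upwards [this] with X hX
  rw [h0]
  exact h _ (expMap_mem_unitaryGroup hU X) hX

theorem IsMaxNear.fderiv_eq_zero (hmax : IsMaxNear f U) (hU : U ∈ unitaryGroup (Fin n) ℂ) :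
    fderiv ℝ (fun X : tangentSpace U => f (expMap U X)) 0 = 0 :=
  (hmax.isLocalMax hU).fderiv_eq_zero

theorem IsMaxNear.hessian_nonpos (hmax : IsMaxNear f U) (hf : ContDiff ℝ ⊤ f)
    (hU : U ∈ unitaryGroup (Fin n) ℂ) (X : tangentSpace U) : hessian f U X X ≤ 0 := by
  have h := tendsto_second_difference ((contDiff_comp_expMap (U := U) hf).of_le le_top)
    (hmax.fderiv_eq_zero hU) X
  have hle : (1 / 2 * hessian f U X X) ≤ 0 := by
    refine le_of_tendsto h ?_
    have hc : Filter.Tendsto (fun t : ℝ => t • X) (𝓝[≠] 0) (𝓝 0) := by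
      have : Continuous fun t : ℝ => t • X := by fun_prop
      simpa using (this.tendsto 0).mono_left nhdsWithin_le_nhds
    filter_upwards [hc.eventually (hmax.isLocalMax hU)] with t ht
    exact div_nonpos_of_nonpos_of_nonneg (sub_nonpos.2 ht) (sq_nonneg t)
  linarith

/-- Along these directions `f ∘ Exp` is constant, so the quadratic form vanishes there; a null
vector of a semidefinite form lies in its kernel. -/
theorem IsMaxNear.hessian_diagonalTangent (hmax : IsMaxNear f U) (hf : ContDiff ℝ ⊤ f)
    (hU : U ∈ unitaryGroup (Fin n) ℂ)
    (hinv : ∀ z : Fin n → ℂ, (∀ i, ‖z i‖ = 1) → ∀ X, f (X * diagonal z) = f X) (x : Fin n → ℝ) :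
    hessian f U (diagonalTangent hU x) = 0 := by
  refine eq_zero_of_nonpos_of_symm (hessian_symm hf) (hmax.hessian_nonpos hf hU) ?_
  have h := tendsto_second_difference ((contDiff_comp_expMap (U := U) hf).of_le le_top)
    (hmax.fderiv_eq_zero hU) (diagonalTangent hU x)
  have h0 : ∀ t : ℝ, f (expMap U ((t • diagonalTangent hU x : tangentSpace U) :
      Matrix (Fin n) (Fin n) ℂ)) = f U := fun t => by
    rw [← map_smul, expMap_diagonalTangent]
    exact hinv _ (fun i => Complex.norm_exp_ofReal_mul_I _) _
  have h1 : f (expMap U ((0 : tangentSpace U) : Matrix (Fin n) (Fin n) ℂ)) = f U :=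
    congrArg f (expMap_zero U)
  simp only [h0, h1, sub_self, zero_div] at h
  have := tendsto_nhds_unique h tendsto_const_nhds
  change 1 / 2 * hessian f U _ _ = 0 at this
  linarith

/-- A dimension count: the kernel contains the `n`-dimensional space of diagonal directions and has
dimension at most `n² - n(n-1) = n`. -/
theorem IsMaxNear.ker_hessian_le (hmax : IsMaxNear f U) (hf : ContDiff ℝ ⊤ f)
    (hU : U ∈ unitaryGroup (Fin n) ℂ)
    (hinv : ∀ z : Fin n → ℂ, (∀ i, ‖z i‖ = 1) → ∀ X, f (X * diagonal z) = f X)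
    (hrank : hessianRank f U = n * (n - 1)) :
    LinearMap.ker (hessian f U).toLinearMap ≤ LinearMap.range (diagonalTangent hU) := by
  have hle : LinearMap.range (diagonalTangent hU) ≤ LinearMap.ker (hessian f U).toLinearMap := by
    rintro _ ⟨x, rfl⟩
    exact hmax.hessian_diagonalTangent hf hU hinv x
  have h1 := LinearMap.finrank_range_add_finrank_ker (K := ℝ) (V := tangentSpace U)
    (V₂ := tangentSpace U →L[ℝ] ℝ) (hessian f U).toLinearMap
  rw [← hessianRank_eq, hrank] at h1
  have h2 := finrank_tangentSpace_le hU
  have h3 : Module.finrank ℝ (LinearMap.range (diagonalTangent hU)) = n := by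
    rw [LinearMap.finrank_range_of_inj (diagonalTangent_injective hU)]
    simp
  refine (Submodule.eq_of_le_of_finrank_le hle ?_).ge
  rw [h3]
  have h4 : n * n = n * (n - 1) + n := by
    cases n with
    | zero => rfl
    | succ m => simp [Nat.mul_succ]
  omega

theorem IsMaxNear.hessian_neg (hmax : IsMaxNear f U) (hf : ContDiff ℝ ⊤ f)
    (hU : U ∈ unitaryGroup (Fin n) ℂ)
    (hinv : ∀ z : Fin n → ℂ, (∀ i, ‖z i‖ = 1) → ∀ X, f (X * diagonal z) = f X)
    (hrank : hessianRank f U = n * (n - 1)) {X : tangentSpace U}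
    (hX : ∀ p, (Uᴴ * (X : Matrix (Fin n) (Fin n) ℂ)) p p = 0) (hX0 : X ≠ 0) :
    hessian f U X X < 0 := by
  refine lt_of_le_of_ne (hmax.hessian_nonpos hf hU X) fun h => hX0 ?_
  have hker := eq_zero_of_nonpos_of_symm (hessian_symm hf) (hmax.hessian_nonpos hf hU) h
  obtain ⟨x, rfl⟩ := hmax.ker_hessian_le hf hU hinv hrank hker
  have hx : x = 0 := by
    funext p
    have h1 := hX p
    change (Uᴴ * (U * diagonal fun p => (x p : ℂ) * Complex.I)) p p = 0 at h1
    rw [← mul_assoc, conjTranspose_mul_self hU, one_mul, diagonal_apply_eq] at h1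
    simpa using h1
  rw [hx, map_zero]

theorem IsMaxNear.exists_hessian_le (hmax : IsMaxNear f U) (hf : ContDiff ℝ ⊤ f)
    (hU : U ∈ unitaryGroup (Fin n) ℂ)
    (hinv : ∀ z : Fin n → ℂ, (∀ i, ‖z i‖ = 1) → ∀ X, f (X * diagonal z) = f X)
    (hrank : hessianRank f U = n * (n - 1)) :
    ∃ μ > 0, ∀ X : tangentSpace U, (∀ p, (Uᴴ * (X : Matrix (Fin n) (Fin n) ℂ)) p p = 0) →
      hessian f U X X ≤ -μ * ‖X‖ ^ 2 := by
  set S : Set (tangentSpace U) :=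
    {X | ∀ p, (Uᴴ * (X : Matrix (Fin n) (Fin n) ℂ)) p p = 0} ∩ Metric.sphere 0 1 with hS
  have hc : Continuous fun X : tangentSpace U => Uᴴ * (X : Matrix (Fin n) (Fin n) ℂ) :=
    continuous_const.mul continuous_subtype_val
  have hclosed : IsClosed {X : tangentSpace U |
      ∀ p, (Uᴴ * (X : Matrix (Fin n) (Fin n) ℂ)) p p = 0} := by
    rw [Set.ofPred_forall]
    exact isClosed_iInter fun p => isClosed_eq (hc.matrix_elem p p) continuous_const
  have hcomp : IsCompact S := (isCompact_sphere 0 1).inter_left hclosed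
  have hcont : Continuous fun X : tangentSpace U => hessian f U X X :=
    (hessian f U).continuous.clm_apply continuous_id
  have hscale : ∀ μ : ℝ, (∀ X ∈ S, hessian f U X X ≤ -μ) → ∀ X : tangentSpace U,
      (∀ p, (Uᴴ * (X : Matrix (Fin n) (Fin n) ℂ)) p p = 0) →
      hessian f U X X ≤ -μ * ‖X‖ ^ 2 := by
    intro μ hμ X hX
    rcases eq_or_ne X 0 with rfl | hX0
    · simp
    have hn : ‖X‖ ≠ 0 := norm_ne_zero_iff.2 hX0
    have h := hμ (‖X‖⁻¹ • X) ⟨fun p => by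
      simp only [Submodule.coe_smul, mul_smul_comm, Matrix.smul_apply, hX p, smul_zero], by
      rw [mem_sphere_zero_iff_norm, norm_smul, norm_inv, norm_norm, inv_mul_cancel₀ hn]⟩
    simp only [map_smul, _root_.smul_apply, smul_eq_mul] at h
    have h2 : 0 < ‖X‖ ^ 2 := by positivity
    calc hessian f U X X = (‖X‖⁻¹ * (‖X‖⁻¹ * hessian f U X X)) * ‖X‖ ^ 2 := by field_simp
      _ ≤ -μ * ‖X‖ ^ 2 := by gcongr
  -- With no unit vector of zero diagonal the bound is vacuous and any `μ` serves; otherwise `-μ` is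
  -- the maximum of the form over the compact set `S`.
  rcases S.eq_empty_or_nonempty with he | hne
  · exact ⟨1, one_pos, hscale 1 (by simp [he])⟩
  · obtain ⟨X₀, hX₀, hX₀'⟩ := hcomp.exists_isMaxOn hne hcont.continuousOn
    have hneg := hmax.hessian_neg hf hU hinv hrank hX₀.1 (by
      rintro rfl
      simpa using hX₀.2)
    exact ⟨-hessian f U X₀ X₀, by linarith, hscale _ fun X hX => by
      rw [neg_neg]; exact hX₀' hX⟩

end Hessian

/-! ### Quadratic growth and the gradient bound near the maximum -/

section Local

variable {n : ℕ} {U : Matrix (Fin n) (Fin n) ℂ} {f : Matrix (Fin n) (Fin n) ℂ → ℝ}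

theorem exists_norm_exp_sub_le :
    ∃ K ≥ 0, ∀ᶠ Z : Matrix (Fin n) (Fin n) ℂ in 𝓝 0,
      ‖NormedSpace.exp Z - (1 + Z + (1 / 2 : ℝ) • (Z * Z))‖ ≤ K * ‖Z‖ ^ 3 := by
  have h := (NormedSpace.exp_hasFPowerSeriesAt_zero (𝕂 := ℝ)
    (𝔸 := Matrix (Fin n) (Fin n) ℂ)).isBigO_sub_partialSum_pow 3
  obtain ⟨K, hK, hK'⟩ := h.exists_nonneg
  refine ⟨K, hK, ?_⟩
  filter_upwards [hK'.bound] with Z hZ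
  have e : (NormedSpace.expSeries ℝ (Matrix (Fin n) (Fin n) ℂ)).partialSum 3 Z =
      1 + Z + (1 / 2 : ℝ) • (Z * Z) := by
    simp [FormalMultilinearSeries.partialSum, Finset.sum_range_succ,
      NormedSpace.expSeries_apply_eq, sq, Nat.factorial]
  rw [e, zero_add, norm_pow, norm_norm] at hZ
  exact hZ

/-- The skew-Hermitian part of a matrix. -/
noncomputable def skewPart (V : Matrix (Fin n) (Fin n) ℂ) : Matrix (Fin n) (Fin n) ℂ :=
  (1 / 2 : ℝ) • (V - Vᴴ)

theorem skewPart_conjTranspose (V : Matrix (Fin n) (Fin n) ℂ) : (skewPart V)ᴴ = -skewPart V := by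
  rw [skewPart, conjTranspose_smul, conjTranspose_sub, conjTranspose_conjTranspose, star_trivial,
    ← smul_neg, neg_sub]

theorem continuous_skewPart : Continuous (skewPart (n := n)) :=
  (continuous_id.sub continuous_id.matrix_conjTranspose).const_smul (1 / 2 : ℝ)

theorem skewPart_one : skewPart (1 : Matrix (Fin n) (Fin n) ℂ) = 0 := by
  simp [skewPart]

theorem skewPart_apply_self {V : Matrix (Fin n) (Fin n) ℂ} {p : Fin n} (hp : (V p p).im = 0) :
    skewPart V p p = 0 := by
  simp only [skewPart, Matrix.smul_apply, Matrix.sub_apply, conjTranspose_apply]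
  have : star (V p p) = V p p := Complex.conj_eq_iff_im.2 hp
  rw [this, sub_self, smul_zero]

theorem norm_skewPart_le (V : Matrix (Fin n) (Fin n) ℂ) : ‖skewPart V‖ ≤ ‖V - 1‖ := by
  have h : skewPart V = (1 / 2 : ℝ) • ((V - 1) - (V - 1)ᴴ) := by
    rw [skewPart, conjTranspose_sub, conjTranspose_one, sub_sub_sub_cancel_right]
  rw [h, norm_smul]
  have := norm_sub_le (V - 1) (V - 1)ᴴ
  rw [frobenius_norm_conjTranspose] at this
  rw [Real.norm_of_nonneg (by norm_num)]
  linarith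

theorem sub_one_eq_skewPart_sub {V : Matrix (Fin n) (Fin n) ℂ} (hV : V ∈ unitaryGroup (Fin n) ℂ) :
    V - 1 = skewPart V - (1 / 2 : ℝ) • ((V - 1) * (V - 1)ᴴ) := by
  have h : (V - 1) * (V - 1)ᴴ = (2 : ℝ) • 1 - V - Vᴴ := by
    rw [conjTranspose_sub, conjTranspose_one, sub_mul, mul_sub, self_mul_conjTranspose hV, mul_one,
      one_mul, two_smul]
    abel
  rw [h, skewPart]
  module

/-- The skew part replaces the logarithm: a unitary `V` near `1` is the exponential of its skew part
up to third order, by comparing `V = 1 + Z - W Wᴴ / 2` with `exp Z ≈ 1 + Z + Z² / 2`, where `W = V -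
1`. -/
theorem norm_sub_exp_skewPart_le {V : Matrix (Fin n) (Fin n) ℂ} (hV : V ∈ unitaryGroup (Fin n) ℂ)
    {K : ℝ} (hK : 0 ≤ K)
    (h : ‖NormedSpace.exp (skewPart V) -
      (1 + skewPart V + (1 / 2 : ℝ) • (skewPart V * skewPart V))‖ ≤ K * ‖skewPart V‖ ^ 3) :
    ‖V - NormedSpace.exp (skewPart V)‖ ≤ (1 / 2 + K) * ‖V - 1‖ ^ 3 := by
  have hW := sub_one_eq_skewPart_sub hV
  have hle := norm_skewPart_le V
  have hZs := skewPart_conjTranspose V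
  set W := V - 1 with hWdef
  set Z := skewPart V
  clear_value W Z
  have hdiff : ‖W - Z‖ ≤ 1 / 2 * ‖W‖ ^ 2 := by
    have : W - Z = -((1 / 2 : ℝ) • (W * Wᴴ)) := by
      rw [sub_eq_iff_eq_add, neg_add_eq_sub]
      exact hW
    rw [this, norm_neg, norm_smul, Real.norm_of_nonneg (by norm_num)]
    have := frobenius_norm_mul W Wᴴ
    rw [frobenius_norm_conjTranspose] at this
    nlinarith
  -- Since `Z² = -Z Zᴴ`, this is the difference of two products whose factors differ by a
  -- second-order term, hence of third order.
  have h1 : W * Wᴴ + Z * Z = (W - Z) * Wᴴ + Z * (W - Z)ᴴ := by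
    rw [conjTranspose_sub W Z, hZs, sub_neg_eq_add, mul_add, sub_mul]
    abel
  have h2 : ‖W * Wᴴ + Z * Z‖ ≤ ‖W‖ ^ 3 := by
    rw [h1]
    refine (norm_add_le _ _).trans ?_
    have a1 := frobenius_norm_mul (W - Z) Wᴴ
    have a2 := frobenius_norm_mul Z (W - Z)ᴴ
    rw [frobenius_norm_conjTranspose] at a1 a2
    have b1 : ‖W - Z‖ * ‖W‖ ≤ 1 / 2 * ‖W‖ ^ 2 * ‖W‖ := by gcongr
    have b2 : ‖Z‖ * ‖W - Z‖ ≤ ‖W‖ * (1 / 2 * ‖W‖ ^ 2) := by gcongr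
    calc _ ≤ 1 / 2 * ‖W‖ ^ 2 * ‖W‖ + ‖W‖ * (1 / 2 * ‖W‖ ^ 2) :=
          add_le_add (a1.trans b1) (a2.trans b2)
      _ = ‖W‖ ^ 3 := by ring
  have h3 : V - NormedSpace.exp Z = -((1 / 2 : ℝ) • (W * Wᴴ + Z * Z)) -
      (NormedSpace.exp Z - (1 + Z + (1 / 2 : ℝ) • (Z * Z))) := by
    have : V = 1 + (Z - (1 / 2 : ℝ) • (W * Wᴴ)) := by rw [← hW, hWdef]; abel
    rw [this, smul_add]
    abel
  rw [h3]
  refine (norm_sub_le _ _).trans ?_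
  rw [norm_neg, norm_smul, Real.norm_of_nonneg (by norm_num)]
  have h4 : K * ‖Z‖ ^ 3 ≤ K * ‖W‖ ^ 3 := by gcongr
  linarith

/-- Continuous differentiability makes `Y ↦ (Z ↦ Df(Y)(Y Z))` Lipschitz near `U`, so `V` can be
replaced by `exp (skewPart V)` in the derivative bound. -/
theorem contDiff_fderiv_comp_mul (hf : ContDiff ℝ ⊤ f) :
    ContDiff ℝ 1 fun Y : Matrix (Fin n) (Fin n) ℂ =>
      (fderiv ℝ f Y).comp (ContinuousLinearMap.mul ℝ (Matrix (Fin n) (Fin n) ℂ) Y) :=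
  (hf.fderiv_right (m := 1) le_top).clm_comp
    (ContinuousLinearMap.mul ℝ (Matrix (Fin n) (Fin n) ℂ)).contDiff

/-- Both sides are the derivative at `t = 1` of `f (U exp (t Z))`. Only the radial derivative of the
exponential is needed, and it is explicit. -/
theorem fderiv_comp_expMap_self (hf : ContDiff ℝ ⊤ f) (hU : U ∈ unitaryGroup (Fin n) ℂ)
    {Z : Matrix (Fin n) (Fin n) ℂ} (hZ : Zᴴ = -Z) :
    fderiv ℝ (fun X : tangentSpace U => f (expMap U X)) ⟨U * Z, mul_mem_tangentSpace hU hZ⟩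
      ⟨U * Z, mul_mem_tangentSpace hU hZ⟩ =
    fderiv ℝ f (U * NormedSpace.exp Z) (U * NormedSpace.exp Z * Z) := by
  set X : tangentSpace U := ⟨U * Z, mul_mem_tangentSpace hU hZ⟩ with hX
  have hc : HasDerivAt (fun t : ℝ => t • X) X 1 := by
    have := (hasDerivAt_id (1 : ℝ)).smul_const X
    rwa [one_smul] at this
  have hF : HasFDerivAt (fun X : tangentSpace U => f (expMap U X))
      (fderiv ℝ (fun X : tangentSpace U => f (expMap U X)) X) ((1 : ℝ) • X) := by
    rw [one_smul]
    exact ((contDiff_comp_expMap (U := U) hf).differentiable (by simp) X).hasFDerivAt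
  have h1 := hF.comp_hasDerivAt (1 : ℝ) hc
  have he : HasDerivAt (fun t : ℝ => U * NormedSpace.exp (t • Z)) (U * NormedSpace.exp Z * Z) 1 := by
    have := (hasDerivAt_exp_smul_const Z (1 : ℝ)).const_mul U
    rwa [one_smul, ← mul_assoc] at this
  have hf' : HasFDerivAt f (fderiv ℝ f (U * NormedSpace.exp Z))
      (U * NormedSpace.exp ((1 : ℝ) • Z)) := by
    rw [one_smul]
    exact (hf.differentiable (by simp) _).hasFDerivAt
  have h2 := hf'.comp_hasDerivAt (1 : ℝ) he
  have e : ((fun X : tangentSpace U => f (expMap U X)) ∘ fun t : ℝ => t • X) =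
      (f ∘ fun t : ℝ => U * NormedSpace.exp (t • Z)) := by
    funext t
    simp only [Function.comp_apply, Submodule.coe_smul, expMap_eq, hX, mul_smul_comm, ← mul_assoc,
      conjTranspose_mul_self hU, one_mul]
  rw [e] at h1
  exact h1.unique h2

/-- The real inequalities behind the local estimates: `w`, `o`, `e` stand for `‖V - 1‖`,
`‖skewPart V‖` and `‖V - exp (skewPart V)‖`. -/
theorem local_bounds {μ Kb K₁ K₂ L w o e b y₀ y y' g g' : ℝ} (hμ : 0 < μ) (hKb : 0 ≤ Kb)
    (hK₁ : 0 ≤ K₁) (hK₂ : 0 ≤ K₂) (hL : 0 ≤ L) (hw0 : 0 ≤ w) (ho0 : 0 ≤ o) (ho : o ≤ w)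
    (hwo : w ≤ o + 1 / 2 * w ^ 2) (hw1 : w ≤ 1 / 2) (hw2 : (K₁ + K₂ + 1) * L * w ≤ μ / 16)
    (he : e ≤ L * w ^ 3) (hb : b ≤ -μ * o ^ 2) (hb' : |b| ≤ Kb * o ^ 2)
    (hT : |y' - y₀ - 1 / 2 * b| ≤ μ / 4 * o ^ 2) (hD : |g' - b| ≤ μ / 4 * o ^ 2)
    (hy : |y - y'| ≤ K₁ * e) (hg : |g - g'| ≤ K₂ * e * o) :
    y ≤ y₀ - μ / 16 * w ^ 2 ∧ y₀ - y ≤ (Kb + μ + (K₁ + K₂ + 1) * L) * w ^ 2 ∧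
      μ / 16 * w ^ 2 ≤ |g| := by
  set M := (K₁ + K₂ + 1) * L with hM
  -- From `w ≤ 1 / 2` and `hwo` follows `o ≥ 3w / 4`, and `9 / 16 ≥ 1 / 2`.
  have how : w ^ 2 / 2 ≤ o ^ 2 := by
    have : 3 / 4 * w ≤ o := by nlinarith
    nlinarith
  have how' : o ^ 2 ≤ w ^ 2 := by gcongr
  have hM3 : M * w ^ 3 ≤ μ / 16 * w ^ 2 := by
    calc M * w ^ 3 = (M * w) * w ^ 2 := by ring
      _ ≤ _ := by gcongr
  have hLw : 0 ≤ L * w ^ 3 := by positivity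
  have hA : K₁ * e ≤ M * w ^ 3 := by
    calc K₁ * e ≤ K₁ * (L * w ^ 3) := by gcongr
      _ ≤ (K₁ + K₂ + 1) * (L * w ^ 3) := by gcongr; linarith
      _ = M * w ^ 3 := by rw [hM]; ring
  have hA2 : K₂ * e * o ≤ M * w ^ 3 := by
    calc K₂ * e * o ≤ K₂ * (L * w ^ 3) * 1 := by gcongr; linarith
      _ ≤ (K₁ + K₂ + 1) * (L * w ^ 3) := by rw [mul_one]; gcongr; linarith
      _ = M * w ^ 3 := by rw [hM]; ring
  have hT' := abs_le.1 hT
  have hD' := abs_le.1 hD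
  have hy' := abs_le.1 (hy.trans hA)
  have hg' := abs_le.1 (hg.trans hA2)
  have hb'' := abs_le.1 hb'
  have hμo : μ * (w ^ 2 / 2) ≤ μ * o ^ 2 := by gcongr
  have hμo' : μ * o ^ 2 ≤ μ * w ^ 2 := by gcongr
  have h1 : Kb * o ^ 2 ≤ Kb * w ^ 2 := by gcongr
  have h2 : 0 ≤ Kb * w ^ 2 := by positivity
  have h3 : 0 ≤ M * w ^ 2 := by positivity
  have h4 : 0 ≤ μ * w ^ 2 := by positivity
  -- For the first bound: the Hessian gives `-μ o² / 2`, the Taylor error takes back `μ o² / 4`, and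
  -- the third-order terms `μ w² / 16`; with `o² ≥ w² / 2` this leaves `-μ w² / 16`.
  refine ⟨by linarith, by linarith, le_trans ?_ (neg_le_abs _)⟩
  linarith

/-- A real diagonal of `V` means that `skewPart V` has zero diagonal, so `U * skewPart V` is
transverse to the orbit and the definite Hessian bound applies to it. The third-order distance from
`V` to `exp (skewPart V)` is absorbed for small `V - 1`. -/
theorem IsMaxNear.local_estimates (hmax : IsMaxNear f U) (hf : ContDiff ℝ ⊤ f)
    (hU : U ∈ unitaryGroup (Fin n) ℂ)
    (hinv : ∀ z : Fin n → ℂ, (∀ i, ‖z i‖ = 1) → ∀ X, f (X * diagonal z) = f X)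
    (hrank : hessianRank f U = n * (n - 1)) :
    ∃ r > 0, ∃ μ > 0, ∃ K > 0, ∀ V ∈ unitaryGroup (Fin n) ℂ, (∀ p, (V p p).im = 0) →
      ‖V - 1‖ < r →
      f (U * V) ≤ f U - μ * ‖V - 1‖ ^ 2 ∧ f U - f (U * V) ≤ K * ‖V - 1‖ ^ 2 ∧
      μ * ‖V - 1‖ ^ 2 ≤ |fderiv ℝ f (U * V) (U * V * skewPart V)| := by
  obtain ⟨μ, hμ, hB⟩ := hmax.exists_hessian_le hf hU hinv hrank
  obtain ⟨Kb, hKb, hBb⟩ := exists_abs_apply_self_le (hessian f U)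
  obtain ⟨K₀, hK₀, hexp⟩ := exists_norm_exp_sub_le (n := n)
  obtain ⟨K₁, s₁, hs₁, hL₁⟩ := (hf.of_le (m := 1) le_top).contDiffAt (x := U)
    |>.exists_lipschitzOnWith
  obtain ⟨K₂, s₂, hs₂, hL₂⟩ := (contDiff_fderiv_comp_mul hf).contDiffAt (x := U)
    |>.exists_lipschitzOnWith
  have hF : ContDiff ℝ 2 fun X : tangentSpace U => f (expMap U X) :=
    (contDiff_comp_expMap (U := U) hf).of_le le_top
  have hF0 := hmax.fderiv_eq_zero hU
  let X : Matrix (Fin n) (Fin n) ℂ → tangentSpace U := fun V =>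
    ⟨U * skewPart V, mul_mem_tangentSpace hU (skewPart_conjTranspose V)⟩
  have hXc : Continuous X :=
    Continuous.subtype_mk (continuous_const.mul continuous_skewPart) _
  have hX1 : X 1 = 0 := by
    ext1
    simp only [X, skewPart_one, mul_zero, Submodule.coe_zero]
  have hXt : Filter.Tendsto X (𝓝 1) (𝓝 0) := by rw [← hX1]; exact hXc.tendsto 1
  have hUV : Filter.Tendsto (fun V => U * V) (𝓝 1) (𝓝 U) := by
    have : Continuous fun V : Matrix (Fin n) (Fin n) ℂ => U * V := continuous_const.mul continuous_id
    simpa using this.tendsto 1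
  have hZt : Filter.Tendsto skewPart (𝓝 (1 : Matrix (Fin n) (Fin n) ℂ)) (𝓝 0) := by
    rw [← skewPart_one]; exact continuous_skewPart.tendsto 1
  have hUE : Filter.Tendsto (fun V => U * NormedSpace.exp (skewPart V)) (𝓝 1) (𝓝 U) := by
    have : Continuous fun V : Matrix (Fin n) (Fin n) ℂ => U * NormedSpace.exp (skewPart V) :=
      continuous_const.mul (contDiff_exp.continuous.comp continuous_skewPart)
    simpa [skewPart_one] using this.tendsto 1
  set L : ℝ := (1 / 2 + K₀) with hL
  set M : ℝ := ((K₁ : ℝ) + K₂ + 1) * L with hM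
  have hL0 : 0 < L := by positivity
  have hM0 : 0 < M := by positivity
  have hw : ∀ᶠ V : Matrix (Fin n) (Fin n) ℂ in 𝓝 1, ‖V - 1‖ < min (1 / 2) (μ / (16 * M)) := by
    have hc : Continuous fun V : Matrix (Fin n) (Fin n) ℂ => ‖V - 1‖ :=
      (continuous_id.sub continuous_const).norm
    refine hc.continuousAt.eventually_lt continuousAt_const ?_
    rw [sub_self, norm_zero]
    positivity
  have hall := (hUV.eventually hs₁).and <| (hUV.eventually hs₂).and <| (hUE.eventually hs₁).and <|
    (hUE.eventually hs₂).and <| (hZt.eventually hexp).and <|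
    (hXt.eventually (eventually_abs_sub_taylor_le hF (ε := μ / 4) (by positivity))).and <|
    (hXt.eventually (eventually_abs_fderiv_self_sub_le hF (ε := μ / 4) (by positivity))).and hw
  obtain ⟨r, hr, hball⟩ := Metric.eventually_nhds_iff.1 hall
  refine ⟨r, hr, μ / 16, by positivity, Kb + μ + M, by positivity, ?_⟩
  intro V hV hdiag hVr
  obtain ⟨m1, m2, m3, m4, hE, hT, hD, hsmall⟩ := hball (y := V) (by rwa [dist_eq_norm])
  have hclose := norm_sub_exp_skewPart_le hV hK₀ hE
  have hZs := skewPart_conjTranspose V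
  have hXn : ‖X V‖ = ‖skewPart V‖ := norm_unitary_mul hU _
  have hBX := hB (X V) fun p => by
    change (Uᴴ * (U * skewPart V)) p p = 0
    rw [← mul_assoc, conjTranspose_mul_self hU, one_mul]
    exact skewPart_apply_self (hdiag p)
  have hBX' := hBb (X V)
  have hFX : f (expMap U (X V)) = f (U * NormedSpace.exp (skewPart V)) := by
    rw [expMap_eq]
    congr 3
    change Uᴴ * (U * skewPart V) = _
    rw [← mul_assoc, conjTranspose_mul_self hU, one_mul]
  have hdF := fderiv_comp_expMap_self hf hU hZs
  change fderiv ℝ _ (X V) (X V) = _ at hdF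
  rw [hF0] at hT hD
  simp only [_root_.zero_apply, sub_zero] at hT hD
  rw [hFX] at hT
  have h0 : f (expMap U ((0 : tangentSpace U) : Matrix (Fin n) (Fin n) ℂ)) = f U :=
    congrArg f (expMap_zero U)
  rw [h0] at hT
  change |_ - 1 / 2 * hessian f U (X V) (X V)| ≤ _ at hT
  rw [hdF] at hD
  change |_ - hessian f U (X V) (X V)| ≤ _ at hD
  have hf1 := hL₁.dist_le_mul _ m1 _ m3
  have hf2 := hL₂.dist_le_mul _ m2 _ m4
  rw [dist_eq_norm, dist_eq_norm, ← mul_sub, norm_unitary_mul hU] at hf1 hf2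
  rw [Real.norm_eq_abs] at hf1
  have hf2' : |fderiv ℝ f (U * V) (U * V * skewPart V) -
      fderiv ℝ f (U * NormedSpace.exp (skewPart V))
        (U * NormedSpace.exp (skewPart V) * skewPart V)| ≤
      K₂ * ‖V - NormedSpace.exp (skewPart V)‖ * ‖skewPart V‖ := by
    have := (ContinuousLinearMap.le_opNorm _ (skewPart V)).trans
      (mul_le_mul_of_nonneg_right hf2 (norm_nonneg (skewPart V)))
    exact this
  have ho := norm_skewPart_le V
  have hwo : ‖V - 1‖ ≤ ‖skewPart V‖ + 1 / 2 * ‖V - 1‖ ^ 2 := by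
    have h1 := sub_one_eq_skewPart_sub hV
    have h2 := norm_sub_le (skewPart V) ((1 / 2 : ℝ) • ((V - 1) * (V - 1)ᴴ))
    rw [← h1, norm_smul, Real.norm_of_nonneg (by norm_num)] at h2
    have h3 := frobenius_norm_mul (V - 1) (V - 1)ᴴ
    rw [frobenius_norm_conjTranspose] at h3
    linarith
  rw [hXn] at hBX hBX' hT hD
  have hw1 : ‖V - 1‖ ≤ 1 / 2 := (hsmall.trans_le (min_le_left _ _)).le
  have hw2 : M * ‖V - 1‖ ≤ μ / 16 := by
    have := hsmall.trans_le (min_le_right _ _)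
    rw [lt_div_iff₀ (by positivity)] at this
    linarith
  exact local_bounds hμ hKb K₁.2 K₂.2 hL0.le (norm_nonneg _) (norm_nonneg _) ho hwo hw1 hw2 hclose
    hBX hBX' hT hD hf1 hf2'

end Local

/-! ### Estimates along the orbit, and the coefficients of the plane rotations -/

section Orbit

variable {n : ℕ} {f : Matrix (Fin n) (Fin n) ℂ → ℝ} {U U₀ : Matrix (Fin n) (Fin n) ℂ}

/-- Up to a diagonal unitary factor on the right, `U` is `U₀` times a unitary matrix that has a real
diagonal and is as close to the identity as `U` is to the orbit of `U₀`. -/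
theorem exists_normal_form (hU₀ : U₀ ∈ unitaryGroup (Fin n) ℂ) (hU : U ∈ unitaryGroup (Fin n) ℂ) :
    ∃ V ∈ unitaryGroup (Fin n) ℂ, ∃ z : Fin n → ℂ, (∀ i, ‖z i‖ = 1) ∧ (∀ p, (V p p).im = 0) ∧
      U = U₀ * V * diagonal z ∧ ‖V - 1‖ = ‖U - U₀ * diagonal z‖ ∧
      ∀ y : Fin n → ℂ, (∀ i, ‖y i‖ = 1) → ‖V - 1‖ ≤ ‖U - U₀ * diagonal y‖ := by
  set Q := U₀ᴴ * U with hQ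
  have hQU : U = U₀ * Q := by rw [hQ, ← mul_assoc, self_mul_conjTranspose hU₀, one_mul]
  have hQmem : Q ∈ unitaryGroup (Fin n) ℂ := mul_mem (Unitary.star_mem hU₀) hU
  -- The unit number nearest to a nonzero `Q p p` is its phase; for a zero entry all are equally
  -- near and `1` is chosen. The off-diagonal entries of `Q - diagonal z` do not depend on `z`.
  set z : Fin n → ℂ := fun p => if Q p p = 0 then 1 else Q p p / ‖Q p p‖ with hzdef
  have hz : ∀ p, ‖z p‖ = 1 := by
    intro p
    simp only [hzdef]
    split_ifs with h
    · simp
    · rw [norm_div, Complex.norm_real, norm_norm, div_self (norm_ne_zero_iff.2 h)]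
  have hQz : ∀ p, Q p p = ‖Q p p‖ * z p := by
    intro p
    simp only [hzdef]
    split_ifs with h
    · simp [h]
    · rw [mul_div_cancel₀]
      exact_mod_cast norm_ne_zero_iff.2 h
  have hzz : ∀ p, z p * star (z p) = 1 := fun p => by
    rw [RCLike.star_def, Complex.mul_conj', hz]; simp
  have hD := diagonal_mem_unitaryGroup hz
  have hDD : (diagonal z)ᴴ * diagonal z = 1 := conjTranspose_mul_self hD
  set V := Q * (diagonal z)ᴴ with hV
  have hVD : V * diagonal z = Q := by rw [hV, mul_assoc, hDD, mul_one]
  have hV1 : ‖V - 1‖ = ‖Q - diagonal z‖ := by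
    rw [← norm_mul_unitary hD, sub_mul, hVD, one_mul]
  have hle : ∀ y : Fin n → ℂ, (∀ i, ‖y i‖ = 1) → ‖Q - diagonal z‖ ≤ ‖Q - diagonal y‖ := by
    intro y hy
    refine abs_le_of_sq_le_sq' ?_ (norm_nonneg _) |>.2
    rw [frobenius_norm_sq, frobenius_norm_sq]
    refine Finset.sum_le_sum fun p _ => Finset.sum_le_sum fun q _ => ?_
    by_cases hpq : p = q
    · subst hpq
      rw [Matrix.sub_apply, Matrix.sub_apply, diagonal_apply_eq, diagonal_apply_eq]
      have h1 : Q p p - z p = ((‖Q p p‖ - 1 : ℝ) : ℂ) * z p := by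
        conv_lhs => rw [hQz p]
        push_cast
        ring
      rw [h1, norm_mul, hz, mul_one, Complex.norm_real, Real.norm_eq_abs]
      have h2 := abs_norm_sub_norm_le (Q p p) (y p)
      rw [hy] at h2
      gcongr
    · rw [Matrix.sub_apply, Matrix.sub_apply, diagonal_apply_ne _ hpq, diagonal_apply_ne _ hpq]
  have hsub : ∀ y : Fin n → ℂ, ‖U - U₀ * diagonal y‖ = ‖Q - diagonal y‖ := fun y => by
    rw [hQU, ← mul_sub, norm_unitary_mul hU₀]
  refine ⟨V, mul_mem hQmem (Unitary.star_mem hD), z, hz, fun p => ?_, ?_, ?_, fun y hy => ?_⟩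
  · rw [hV, diagonal_conjTranspose, mul_diagonal, Pi.star_apply, hQz p, mul_assoc, hzz, mul_one,
      Complex.ofReal_im]
  · rw [mul_assoc, hVD, hQU]
  · rw [hV1, hsub]
  · rw [hV1, hsub]
    exact hle y hy

theorem fderiv_mul_diagonal (hf : ContDiff ℝ ⊤ f) {z : Fin n → ℂ}
    (hinv : ∀ X, f (X * diagonal z) = f X) (X Y : Matrix (Fin n) (Fin n) ℂ) :
    fderiv ℝ f (X * diagonal z) (Y * diagonal z) = fderiv ℝ f X Y := by
  have h1 : HasFDerivAt (fun X : Matrix (Fin n) (Fin n) ℂ => X * diagonal z)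
      ((ContinuousLinearMap.mul ℝ (Matrix (Fin n) (Fin n) ℂ)).flip (diagonal z)) X :=
    ((ContinuousLinearMap.mul ℝ (Matrix (Fin n) (Fin n) ℂ)).flip (diagonal z)).hasFDerivAt
  have h2 := (hf.differentiable (by simp) (X * diagonal z)).hasFDerivAt.comp X h1
  have h3 : (f ∘ fun X : Matrix (Fin n) (Fin n) ℂ => X * diagonal z) = f := funext hinv
  rw [h3] at h2
  rw [h2.fderiv]
  rfl

/-- Phase invariance carries the local estimates to the whole orbit. In the third one the derivative
is bounded by the gradient times `‖skewPart V‖ ≤ ‖V - 1‖`, so one factor `‖V - 1‖` cancels. -/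
theorem IsMaxNear.orbit_estimates (hmax : IsMaxNear f U₀) (hf : ContDiff ℝ ⊤ f)
    (hU₀ : U₀ ∈ unitaryGroup (Fin n) ℂ)
    (hinv : ∀ z : Fin n → ℂ, (∀ i, ‖z i‖ = 1) → ∀ X, f (X * diagonal z) = f X)
    (hrank : hessianRank f U₀ = n * (n - 1)) :
    ∃ r > 0, ∃ μ > 0, ∃ K > 0, ∀ V ∈ unitaryGroup (Fin n) ℂ, (∀ p, (V p p).im = 0) →
      ∀ z : Fin n → ℂ, (∀ i, ‖z i‖ = 1) → ‖V - 1‖ < r →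
      f (U₀ * V * diagonal z) ≤ f U₀ - μ * ‖V - 1‖ ^ 2 ∧
      f U₀ - f (U₀ * V * diagonal z) ≤ K * ‖V - 1‖ ^ 2 ∧
      μ * ‖V - 1‖ ≤ n * ‖riemannianGradient f (U₀ * V * diagonal z)‖ := by
  obtain ⟨r, hr, μ, hμ, K, hK, h⟩ := hmax.local_estimates hf hU₀ hinv hrank
  refine ⟨r, hr, μ, hμ, K, hK, fun V hV hdiag z hz hVr => ?_⟩
  obtain ⟨h1, h2, h3⟩ := h V hV hdiag hVr
  refine ⟨by rwa [hinv z hz], by rwa [hinv z hz], ?_⟩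
  have hD := diagonal_mem_unitaryGroup hz
  set Z := (diagonal z)ᴴ * skewPart V * diagonal z with hZ
  have hZs : Zᴴ = -Z := by
    rw [hZ, conjTranspose_mul, conjTranspose_mul, conjTranspose_conjTranspose,
      skewPart_conjTranspose, neg_mul, mul_neg, ← mul_assoc]
  have hZn : ‖Z‖ ≤ ‖V - 1‖ := by
    rw [hZ, norm_mul_unitary hD]
    exact (norm_unitary_mul (Unitary.star_mem hD) _).trans_le (norm_skewPart_le V)
  have hmem : U₀ * V * diagonal z ∈ unitaryGroup (Fin n) ℂ := mul_mem (mul_mem hU₀ hV) hD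
  have h4 := abs_fderiv_le_riemannianGradient (hf.differentiable (by simp) _) hmem hZs
  have h5 : U₀ * V * diagonal z * Z = U₀ * V * skewPart V * diagonal z := by
    rw [hZ]
    simp only [← mul_assoc]
    rw [mul_assoc (U₀ * V) (diagonal z), self_mul_conjTranspose hD, mul_one]
  rw [h5, fderiv_mul_diagonal hf (hinv z hz)] at h4
  rcases (norm_nonneg (V - 1)).eq_or_lt with h0 | h0
  · rw [← h0, mul_zero]
    positivity
  · refine le_of_mul_le_mul_right ?_ h0
    calc μ * ‖V - 1‖ * ‖V - 1‖ = μ * ‖V - 1‖ ^ 2 := by ring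
      _ ≤ n * (‖riemannianGradient f (U₀ * V * diagonal z)‖ * ‖Z‖) := h3.trans h4
      _ ≤ n * (‖riemannianGradient f (U₀ * V * diagonal z)‖ * ‖V - 1‖) := by gcongr
      _ = _ := by ring

theorem continuous_planeRotation {n : ℕ} (i j : Fin n) (τ : ℝ) :
    Continuous fun p : ℝ × ℝ => planeRotation i j p.1 p.2 τ := by
  refine continuous_matrix fun a b => ?_
  simp only [planeRotation, planeTransformation, givensRotation, of_apply]
  split_ifs <;> (try simp) <;> fun_prop

/-- Along the orbit of a semi-strict local maximum point, every plane rotation has a strict local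
maximum at the angle zero. -/
theorem IsColumnCost.coefficients_orbit (hf : IsColumnCost f) (hmax : IsMaxNear f U₀)
    (hU₀ : U₀ ∈ unitaryGroup (Fin n) ℂ) (hrank : hessianRank f U₀ = n * (n - 1)) {i j : Fin n}
    (hij : i ≠ j) {z : Fin n → ℂ} (hz : ∀ i, ‖z i‖ = 1) {a b A B C : ℝ} (hab : a ^ 2 + b ^ 2 = 1)
    (hABC : ∀ τ, f (U₀ * diagonal z * planeRotation i j a b τ) =
      A + B * Real.cos (4 * τ) + C * Real.sin (4 * τ)) : 0 < B ∧ C = 0 := by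
  obtain ⟨r, hr, μ, hμ, K, hK, h⟩ := hmax.orbit_estimates hf.contDiff hU₀
    (fun z hz => hf.mul_diagonal hz) hrank
  have hD := diagonal_mem_unitaryGroup hz
  have hf0 : f (U₀ * diagonal z) = f U₀ := hf.mul_diagonal hz U₀
  have h0 : f U₀ = A + B := by
    have := hABC 0
    rwa [planeRotation_zero hij, mul_one, hf0, mul_zero, Real.cos_zero, Real.sin_zero, mul_one,
      mul_zero, add_zero] at this
  have hcos : ∀ᶠ τ : ℝ in 𝓝 0, 16 * (1 - Real.cos τ) < r ^ 2 := by
    have hc : Continuous fun τ : ℝ => 16 * (1 - Real.cos τ) := by fun_prop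
    refine hc.continuousAt.eventually_lt continuousAt_const ?_
    simp only [Real.cos_zero, sub_self, mul_zero]
    positivity
  have key : ∀ τ : ℝ, 16 * (1 - Real.cos τ) < r ^ 2 →
      f (U₀ * diagonal z * planeRotation i j a b τ) ≤ f U₀ ∧
      (Real.sin τ ≠ 0 → f (U₀ * diagonal z * planeRotation i j a b τ) < f U₀) := by
    intro τ hτ
    have hG := planeRotation_mem_unitaryGroup hij hab τ
    have hmem := mul_mem (mul_mem hU₀ hD) hG
    obtain ⟨V, hV, y, hy, hdiag, hVU, hVn, hmin⟩ := exists_normal_form hU₀ hmem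
    have hVr : ‖V - 1‖ < r := by
      refine (hmin z hz).trans_lt ?_
      have e : U₀ * diagonal z * planeRotation i j a b τ - U₀ * diagonal z =
          U₀ * diagonal z * (planeRotation i j a b τ - 1) := by rw [mul_sub, mul_one]
      rw [e, norm_unitary_mul (mul_mem hU₀ hD)]
      refine lt_of_pow_lt_pow_left₀ 2 hr.le (lt_of_le_of_lt ?_ hτ)
      refine norm_planeTransformation_givens_sub_one_sq_le hij ?_
      linear_combination Real.cos_sq_add_sin_sq τ + Real.sin τ ^ 2 * hab
    obtain ⟨h1, -, -⟩ := h V hV hdiag y hy hVr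
    rw [← hVU] at h1
    refine ⟨h1.trans (by nlinarith [sq_nonneg ‖V - 1‖]), fun hsin => ?_⟩
    have hpos : 0 < ‖V - 1‖ := by
      rw [hVn, norm_pos_iff, sub_ne_zero]
      intro he
      -- The entry `(j, i)` is `(a - i b) sin τ` times `z j` for the rotated matrix and zero for a
      -- point of the orbit.
      have he' := congrArg (fun M => (U₀ᴴ * M) j i) he
      simp only [← mul_assoc, conjTranspose_mul_self hU₀, one_mul] at he'
      rw [planeRotation, mul_planeTransformation_apply hij, if_pos rfl, diagonal_apply_ne _ hij.symm,
        diagonal_apply_ne _ hij.symm, diagonal_apply_eq, mul_zero, zero_add] at he'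
      have hzj : z j ≠ 0 := norm_ne_zero_iff.1 (by rw [hz]; exact one_ne_zero)
      have hg := (mul_eq_zero.1 he').resolve_right hzj
      simp only [givensRotation, of_apply, cons_val', cons_val_zero, cons_val_one,
        cons_val_fin_one] at hg
      have hre := congrArg Complex.re hg
      have him := congrArg Complex.im hg
      simp only [Complex.sub_re, Complex.sub_im, Complex.mul_re, Complex.mul_im, Complex.ofReal_re,
        Complex.ofReal_im, Complex.I_re, Complex.I_im, Complex.zero_re, Complex.zero_im] at hre him
      have ha : a = 0 := (mul_eq_zero.1 (by linarith : a * Real.sin τ = 0)).resolve_right hsin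
      have hb : b = 0 := (mul_eq_zero.1 (by linarith : b * Real.sin τ = 0)).resolve_right hsin
      rw [ha, hb] at hab
      norm_num at hab
    have : 0 < μ * ‖V - 1‖ ^ 2 := by positivity
    linarith
  constructor
  -- Adding the strict inequality at `τ` to the weak one at `-τ` cancels `C` and leaves `B cos 4τ <
  -- B`.
  · have hsmall : ∀ᶠ τ : ℝ in 𝓝[>] 0, 16 * (1 - Real.cos τ) < r ^ 2 ∧ τ < Real.pi / 8 ∧ 0 < τ :=
      (hcos.filter_mono nhdsWithin_le_nhds).and (((gt_mem_nhds
        (by positivity)).filter_mono nhdsWithin_le_nhds).and self_mem_nhdsWithin)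
    obtain ⟨τ, hτ, hτ1, hτ0⟩ := hsmall.exists
    have hpi := Real.pi_pos
    have hs : 0 < Real.sin τ := Real.sin_pos_of_pos_of_lt_pi hτ0 (by linarith)
    have h1 := (key τ hτ).2 hs.ne'
    have h2 := (key (-τ) (by rwa [Real.cos_neg])).1
    rw [hABC] at h1 h2
    rw [mul_neg, Real.cos_neg, Real.sin_neg] at h2
    have hc : Real.cos (4 * τ) < 1 := by
      have := Real.cos_lt_cos_of_nonneg_of_le_pi (x := 0) (y := 4 * τ) le_rfl (by linarith)
        (by linarith)
      rwa [Real.cos_zero] at this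
    by_contra hB
    nlinarith
  · have hlm : IsLocalMax (fun τ : ℝ => A + B * Real.cos (4 * τ) + C * Real.sin (4 * τ)) 0 := by
      filter_upwards [hcos] with τ hτ
      have := (key τ hτ).1
      rw [hABC] at this
      simpa [h0] using this
    have := hlm.hasDerivAt_eq_zero (hasDerivAt_cos_sin A B C)
    linarith

/-- Expressing `B` and `C` by values of the function shows that they depend continuously on the base
point and on the direction. -/
theorem coefficients_eq {φ : ℝ → ℝ} {A B C : ℝ}
    (h : ∀ τ, φ τ = A + B * Real.cos (4 * τ) + C * Real.sin (4 * τ)) :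
    B = (φ 0 - φ (Real.pi / 4)) / 2 ∧ C = (φ (Real.pi / 8) - φ (-(Real.pi / 8))) / 2 := by
  rw [h, h, h, h, show 4 * (Real.pi / 4) = Real.pi by ring,
    show 4 * (Real.pi / 8) = Real.pi / 2 by ring,
    show 4 * -(Real.pi / 8) = -(Real.pi / 2) by ring]
  simp

/-- On the orbit `B > 0` and `C = 0` for all phases and directions, which range over a compact set.
So `B` has a positive lower bound there, and half of it, together with the smallness of `C`,
persists uniformly nearby. -/
theorem IsColumnCost.eventually_coefficients (hf : IsColumnCost f) (hmax : IsMaxNear f U₀)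
    (hU₀ : U₀ ∈ unitaryGroup (Fin n) ℂ) (hrank : hessianRank f U₀ = n * (n - 1)) :
    ∃ β > 0, ∀ η > 0, ∀ᶠ V in 𝓝 (1 : Matrix (Fin n) (Fin n) ℂ), ∀ i j : Fin n, i ≠ j →
      ∀ z : Fin n → ℂ, (∀ i, ‖z i‖ = 1) → ∀ a b A B C : ℝ, a ^ 2 + b ^ 2 = 1 →
      (∀ τ, f (U₀ * V * diagonal z * planeRotation i j a b τ) =
        A + B * Real.cos (4 * τ) + C * Real.sin (4 * τ)) → β ≤ B ∧ |C| ≤ η := by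
  set S : Set ((Fin n → ℂ) × (ℝ × ℝ)) :=
    {y | ∀ i, ‖y i‖ = 1} ×ˢ {p | p.1 ^ 2 + p.2 ^ 2 = 1} with hS
  have hS1 : IsCompact {y : Fin n → ℂ | ∀ i, ‖y i‖ = 1} := by
    have : {y : Fin n → ℂ | ∀ i, ‖y i‖ = 1} = Set.univ.pi fun _ => Metric.sphere (0 : ℂ) 1 := by
      ext y
      simp
    rw [this]
    exact isCompact_univ_pi fun _ => isCompact_sphere _ _
  have hS2 : IsCompact {p : ℝ × ℝ | p.1 ^ 2 + p.2 ^ 2 = 1} := by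
    refine (isCompact_Icc (a := ((-1 : ℝ), (-1 : ℝ))) (b := (1, 1))).of_isClosed_subset
      (isClosed_eq (by fun_prop) continuous_const) ?_
    rintro ⟨x, y⟩ h
    have h : x ^ 2 + y ^ 2 = 1 := h
    refine ⟨⟨?_, ?_⟩, ⟨?_, ?_⟩⟩ <;> simp only <;> nlinarith [sq_nonneg x, sq_nonneg y]
  have hSc : IsCompact S := hS1.prod hS2
  have hcont : ∀ (i j : Fin n) (τ : ℝ), Continuous fun q : Matrix (Fin n) (Fin n) ℂ ×
      ((Fin n → ℂ) × (ℝ × ℝ)) =>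
      f (U₀ * q.1 * diagonal q.2.1 * planeRotation i j q.2.2.1 q.2.2.2 τ) := by
    intro i j τ
    refine hf.contDiff.continuous.comp ?_
    have h1 : Continuous fun q : Matrix (Fin n) (Fin n) ℂ × ((Fin n → ℂ) × (ℝ × ℝ)) =>
        planeRotation i j q.2.2.1 q.2.2.2 τ :=
      (continuous_planeRotation i j τ).comp (continuous_snd.comp continuous_snd)
    have h2 : Continuous fun q : Matrix (Fin n) (Fin n) ℂ × ((Fin n → ℂ) × (ℝ × ℝ)) =>
        diagonal q.2.1 := Continuous.matrix_diagonal (continuous_fst.comp continuous_snd)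
    exact ((continuous_const.mul continuous_fst).mul h2).mul h1
  set b : Fin n → Fin n → Matrix (Fin n) (Fin n) ℂ × ((Fin n → ℂ) × (ℝ × ℝ)) → ℝ := fun i j q =>
    (f (U₀ * q.1 * diagonal q.2.1 * planeRotation i j q.2.2.1 q.2.2.2 0) -
      f (U₀ * q.1 * diagonal q.2.1 * planeRotation i j q.2.2.1 q.2.2.2 (Real.pi / 4))) / 2 with hb
  set c : Fin n → Fin n → Matrix (Fin n) (Fin n) ℂ × ((Fin n → ℂ) × (ℝ × ℝ)) → ℝ := fun i j q =>
    (f (U₀ * q.1 * diagonal q.2.1 * planeRotation i j q.2.2.1 q.2.2.2 (Real.pi / 8)) -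
      f (U₀ * q.1 * diagonal q.2.1 * planeRotation i j q.2.2.1 q.2.2.2 (-(Real.pi / 8)))) / 2 with hc
  have hbc : ∀ i j, Continuous (b i j) := fun i j =>
    ((hcont i j 0).sub (hcont i j _)).div_const 2
  have hcc : ∀ i j, Continuous (c i j) := fun i j =>
    ((hcont i j _).sub (hcont i j _)).div_const 2
  have hone : ∀ i j : Fin n, i ≠ j → ∀ y ∈ S, 0 < b i j (1, y) ∧ c i j (1, y) = 0 := by
    rintro i j hij ⟨z, a, a'⟩ ⟨hz, ha⟩
    obtain ⟨A, B, C, hABC⟩ := hf.exists_eq_cos_sin (U₀ * diagonal z) hij ha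
    have h1 := hf.coefficients_orbit hmax hU₀ hrank hij hz ha hABC
    obtain ⟨hB, hC⟩ := coefficients_eq hABC
    simp only [hb, hc, mul_one, ← hB, ← hC]
    exact h1
  have hβ : ∀ p : Fin n × Fin n, ∃ β > 0, p.1 ≠ p.2 → ∀ y ∈ S, β ≤ b p.1 p.2 (1, y) := by
    intro p
    by_cases hp : p.1 = p.2
    · exact ⟨1, one_pos, fun h => absurd hp h⟩
    · obtain ⟨β, hβ, h⟩ := hSc.exists_forall_le' (f := fun y => b p.1 p.2 (1, y)) (a := 0)
        ((hbc p.1 p.2).comp (Continuous.prodMk_right 1)).continuousOn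
        (fun y hy => (hone _ _ hp y hy).1)
      exact ⟨β, hβ, fun _ => h⟩
  choose β hβ0 hβ using hβ
  obtain ⟨β₀, hβ₀, hβ₀'⟩ : ∃ β₀ > 0, ∀ p, β₀ ≤ β p := by
    by_cases hn : Nonempty (Fin n × Fin n)
    · obtain ⟨p, hp⟩ := Finite.exists_min β
      exact ⟨β p, hβ0 p, hp⟩
    · exact ⟨1, one_pos, fun p => absurd ⟨p⟩ hn⟩
  refine ⟨β₀ / 2, by positivity, fun η hη => ?_⟩
  have hev : ∀ i j : Fin n, i ≠ j → ∀ᶠ V in 𝓝 (1 : Matrix (Fin n) (Fin n) ℂ), ∀ y ∈ S,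
      β₀ / 2 < b i j (V, y) ∧ |c i j (V, y)| < η := by
    intro i j hij
    refine hSc.eventually_forall_of_forall_eventually fun y hy => ?_
    refine (continuousAt_const.eventually_lt (hbc i j).continuousAt ?_).and
      ((hcc i j).abs.continuousAt.eventually_lt continuousAt_const ?_)
    · have h1 := hβ (i, j) hij y hy
      have h2 := hβ₀' (i, j)
      have h3 : β₀ ≤ b i j (1, y) := h2.trans h1
      linarith
    · rw [(hone i j hij y hy).2]
      simpa using hη
  have hev' : ∀ᶠ V in 𝓝 (1 : Matrix (Fin n) (Fin n) ℂ), ∀ i j : Fin n, i ≠ j → ∀ y ∈ S,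
      β₀ / 2 < b i j (V, y) ∧ |c i j (V, y)| < η := by
    refine Filter.eventually_all.2 fun i => Filter.eventually_all.2 fun j => ?_
    by_cases hij : i = j
    · exact Filter.Eventually.of_forall fun _ h => absurd hij h
    · filter_upwards [hev i j hij] with V hV _ using hV
  filter_upwards [hev'] with V hV i j hij z hz a a' A B C ha hABC
  obtain ⟨hB, hC⟩ := coefficients_eq hABC
  have := hV i j hij (z, (a, a')) ⟨hz, ha⟩
  simp only [hb, hc, ← hB, ← hC] at this
  exact ⟨this.1.le, this.2.le⟩

end Orbit

/-! ### Geometric decay -/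

section Sequence

/-- A sequence whose steps are controlled by the decrease of a quantity that decreases by a fixed
fraction of itself converges linearly. -/
theorem exists_linear_limit {E : Type*} [NormedAddCommGroup E] [CompleteSpace E] {x : ℕ → E}
    {a : ℕ → ℝ} {M Γ : ℝ} (hM : 0 ≤ M) (hΓ : 2 ≤ Γ) (ha : ∀ k, 0 ≤ a k)
    (hstep : ∀ k, ‖x (k + 1) - x k‖ ^ 2 ≤ M * (a k - a (k + 1)))
    (hdec : ∀ k, a k ≤ Γ * (a k - a (k + 1))) :
    ∃ L : E, ∃ C c : ℝ, 0 < c ∧ (∀ k : ℕ, ‖x k - L‖ ≤ C * Real.exp (-c * k)) ∧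
      Filter.Tendsto x Filter.atTop (𝓝 L) ∧ Filter.Tendsto a Filter.atTop (𝓝 0) := by
  -- The quantity `a` shrinks by the factor `ρ` at each step. The assumption `2 ≤ Γ` keeps `ρ`
  -- positive, so that its root has a logarithm; the root appears because `a` controls squared
  -- steps.
  set ρ : ℝ := 1 - 1 / Γ with hρ
  have hΓ0 : 0 < Γ := by linarith
  have hΓ1 : 0 < 1 / Γ := by positivity
  have hΓ2 : 1 / Γ ≤ 1 / 2 := by gcongr
  have hρ0 : 0 < ρ := by linarith
  have hρ1 : ρ < 1 := by linarith
  have hρa : ∀ k, a (k + 1) ≤ ρ * a k := by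
    intro k
    have h := hdec k
    rw [← div_le_iff₀' hΓ0] at h
    have : ρ * a k = a k - a k / Γ := by rw [hρ]; ring
    linarith
  have hak : ∀ k, a k ≤ ρ ^ k * a 0 := by
    intro k
    induction k with
    | zero => simp
    | succ k ih =>
      calc a (k + 1) ≤ ρ * a k := hρa k
        _ ≤ ρ * (ρ ^ k * a 0) := by gcongr
        _ = ρ ^ (k + 1) * a 0 := by ring
  set q := √ρ with hq
  have hq0 : 0 < q := Real.sqrt_pos.2 hρ0
  have hq1 : q < 1 := by rw [hq, Real.sqrt_lt' one_pos]; simpa using hρ1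
  have hqρ : q ^ 2 = ρ := Real.sq_sqrt hρ0.le
  have hdist : ∀ k, dist (x k) (x (k + 1)) ≤ √(M * a 0) * q ^ k := by
    intro k
    rw [dist_comm, dist_eq_norm]
    refine abs_le_of_sq_le_sq' ?_ (by positivity) |>.2
    rw [mul_pow, Real.sq_sqrt (mul_nonneg hM (ha 0)), ← pow_mul, mul_comm k 2, pow_mul, hqρ]
    calc _ ≤ M * (a k - a (k + 1)) := hstep k
      _ ≤ M * (ρ ^ k * a 0) := by
        gcongr
        linarith [ha (k + 1), hak k]
      _ = M * a 0 * ρ ^ k := by ring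
  obtain ⟨L, hL⟩ := cauchySeq_tendsto_of_complete (cauchySeq_of_le_geometric q _ hq1 hdist)
  refine ⟨L, √(M * a 0) / (1 - q), -Real.log q, neg_pos.2 (Real.log_neg hq0 hq1), fun k => ?_, hL,
    ?_⟩
  · have h := dist_le_of_le_geometric_of_tendsto q _ hq1 hdist hL k
    rw [dist_eq_norm] at h
    rw [neg_neg, mul_comm (Real.log q), Real.exp_nat_mul, Real.exp_log hq0, div_mul_eq_mul_div]
    exact h
  · refine squeeze_zero ha hak ?_
    simpa using (tendsto_pow_atTop_nhds_zero_of_lt_one hρ0.le hρ1).mul_const (a 0)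

end Sequence

/-! ### One Jacobi step near the orbit, and convergence -/

section Step

variable {n : ℕ} {f : Matrix (Fin n) (Fin n) ℂ → ℝ}

/-- At a maximizing angle `B = ρ cos θ` with the amplitude `ρ ≥ B ≥ β`, so the gain is at least `ρ
(1 - cos θ)`. It is also at most `C sin θ`, since `B cos θ ≤ B`. -/
theorem gain_bounds {B C β θ : ℝ} (hβ : 0 ≤ β) (hB : β ≤ B)
    (hmax : ∀ σ, B * Real.cos σ + C * Real.sin σ ≤ B * Real.cos θ + C * Real.sin θ) :
    β * (1 - Real.cos θ) ≤ B * Real.cos θ + C * Real.sin θ - B ∧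
      B * Real.cos θ + C * Real.sin θ - B ≤ |C| := by
  obtain ⟨σ, hBσ, hCσ⟩ := exists_eq_sqrt_mul_cos_sin B C
  have hρ2 : √(B ^ 2 + C ^ 2) ^ 2 = B ^ 2 + C ^ 2 := Real.sq_sqrt (by positivity)
  have hBρ : B ≤ √(B ^ 2 + C ^ 2) :=
    (le_abs_self B).trans (Real.abs_le_sqrt (by linarith [sq_nonneg C]))
  have hge := hmax σ
  set ρ := √(B ^ 2 + C ^ 2)
  have hρ0 : 0 ≤ ρ := Real.sqrt_nonneg _
  have hρσ : B * Real.cos σ + C * Real.sin σ = ρ := by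
    rw [hBσ, hCσ]
    linear_combination ρ * Real.cos_sq_add_sin_sq σ
  rw [hρσ] at hge
  have hx1 := Real.cos_le_one θ
  have hxy := Real.cos_sq_add_sin_sq θ
  have hy := Real.abs_sin_le_one θ
  set X := Real.cos θ
  set Y := Real.sin θ
  clear_value X Y ρ
  clear hmax hBσ hCσ hρσ
  have hBX : B = ρ * X := by
    -- The squared distance from `(B, C)` to `ρ (cos θ, sin θ)` vanishes because the maximum is at
    -- least `ρ`.
    have h1 : (B - ρ * X) ^ 2 + (C - ρ * Y) ^ 2 = 2 * (ρ * (ρ - (B * X + C * Y))) := by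
      linear_combination ρ ^ 2 * hxy - hρ2
    have h2 : ρ * (ρ - (B * X + C * Y)) ≤ 0 :=
      mul_nonpos_of_nonneg_of_nonpos hρ0 (sub_nonpos.2 hge)
    have h3 : (B - ρ * X) ^ 2 = 0 :=
      le_antisymm (by linarith [sq_nonneg (C - ρ * Y)]) (sq_nonneg _)
    exact sub_eq_zero.1 (pow_eq_zero_iff two_ne_zero |>.1 h3)
  constructor
  · have h1 : β * (1 - X) ≤ ρ * (1 - X) :=
      mul_le_mul_of_nonneg_right (hB.trans hBρ) (sub_nonneg.2 hx1)
    linarith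
  · have h1 : C * Y ≤ |C| * 1 := by
      refine (le_abs_self _).trans ?_
      rw [abs_mul]
      gcongr
    have h2 : B * X ≤ B * 1 := mul_le_mul_of_nonneg_left hx1 (hβ.trans hB)
    linarith

/-- The Jacobi rotation is a plane rotation through an angle `τ` in `[0, π / 4]`, by `c ≥ √2 / 2`,
and `4τ` maximizes the sinusoid. Without this normalization a maximizer of the same value could be
far from the identity, as `f` has period `π / 2` in `τ`. -/
theorem IsColumnCost.jacobi_step (hf : IsColumnCost f) {U : Matrix (Fin n) (Fin n) ℂ}
    (hU : U ∈ unitaryGroup (Fin n) ℂ) {i j : Fin n} (hij : i ≠ j)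
    {Ψ : Matrix (Fin 2) (Fin 2) ℂ} (hΨ : IsJacobiRotation (restriction f i j U) Ψ) {β η : ℝ}
    (hβ : 0 < β) (hcoef : ∀ a b A B C : ℝ, a ^ 2 + b ^ 2 = 1 →
      (∀ τ, f (U * planeRotation i j a b τ) =
        A + B * Real.cos (4 * τ) + C * Real.sin (4 * τ)) → β ≤ B ∧ |C| ≤ η) :
    β * ‖U * planeTransformation i j Ψ - U‖ ^ 2 ≤
        16 * (f (U * planeTransformation i j Ψ) - f U) ∧
      f (U * planeTransformation i j Ψ) - f U ≤ η := by
  obtain ⟨⟨c, s₁, s₂, hcs, hc, rfl⟩, hmaxΨ⟩ := hΨ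
  obtain ⟨θ, hs₁, hs₂⟩ := exists_eq_sqrt_mul_cos_sin s₁ s₂
  have hab : Real.cos θ ^ 2 + Real.sin θ ^ 2 = 1 := Real.cos_sq_add_sin_sq θ
  obtain ⟨A, B, C, hABC⟩ := hf.exists_eq_cos_sin U hij hab
  obtain ⟨hB, hC⟩ := hcoef _ _ A B C hab hABC
  have hle : ∀ τ, f (U * planeRotation i j (Real.cos θ) (Real.sin θ) τ) ≤
      f (U * planeTransformation i j (givensRotation c s₁ s₂)) := fun τ =>
    hmaxΨ _ (givensRotation_mem_unitaryGroup
      (by linear_combination Real.cos_sq_add_sin_sq τ + Real.sin τ ^ 2 * hab))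
  have hc1 : c ≤ 1 := by nlinarith [sq_nonneg s₁, sq_nonneg s₂]
  have hc0 : 0 ≤ c := le_trans (by positivity) hc
  set τ := Real.arccos c with hτ
  have hcos : Real.cos τ = c := Real.cos_arccos (by linarith) hc1
  have hsin : Real.sin τ = √(s₁ ^ 2 + s₂ ^ 2) := by
    rw [hτ, Real.sin_arccos]
    congr 1
    linarith
  have hτ0 : 0 ≤ τ := Real.arccos_nonneg c
  have hτ1 : τ ≤ Real.pi / 4 := by
    by_contra! h
    have := Real.cos_lt_cos_of_nonneg_of_le_pi (by positivity) (Real.arccos_le_pi c) h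
    rw [hcos, Real.cos_pi_div_four] at this
    linarith
  have hrot : planeTransformation i j (givensRotation c s₁ s₂) =
      planeRotation i j (Real.cos θ) (Real.sin θ) τ := by
    rw [planeRotation, hcos, hsin, mul_comm, ← hs₁, mul_comm, ← hs₂]
  have hnorm : ‖U * planeTransformation i j (givensRotation c s₁ s₂) - U‖ ^ 2 ≤ 16 * (1 - c) := by
    have e : U * planeTransformation i j (givensRotation c s₁ s₂) - U =
        U * (planeTransformation i j (givensRotation c s₁ s₂) - 1) := by rw [mul_sub, mul_one]
    rw [e, norm_unitary_mul hU]
    exact norm_planeTransformation_givens_sub_one_sq_le hij hcs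
  have hmax : ∀ σ, B * Real.cos σ + C * Real.sin σ ≤
      B * Real.cos (4 * τ) + C * Real.sin (4 * τ) := by
    intro σ
    have h := hle (σ / 4)
    rw [hrot, hABC, hABC, show 4 * (σ / 4) = σ by ring] at h
    linarith
  obtain ⟨h1, h2⟩ := gain_bounds hβ.le hB hmax
  have h0 := hABC 0
  rw [planeRotation_zero hij, mul_one, mul_zero, Real.cos_zero, Real.sin_zero] at h0
  -- Here `0 ≤ τ ≤ 4τ ≤ π`, so `1 - c ≤ 1 - cos 4τ`, which the gain controls.
  have hcx : Real.cos (4 * τ) ≤ c := by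
    rw [← hcos]
    exact Real.cos_le_cos_of_nonneg_of_le_pi hτ0 (by linarith) (by linarith)
  have hgain : f (U * planeTransformation i j (givensRotation c s₁ s₂)) - f U =
      B * Real.cos (4 * τ) + C * Real.sin (4 * τ) - B := by
    rw [hrot, hABC, h0]
    ring
  rw [hgain]
  refine ⟨?_, h2.trans hC⟩
  calc _ ≤ β * (16 * (1 - Real.cos (4 * τ))) := by
        gcongr
        linarith
    _ = 16 * (β * (1 - Real.cos (4 * τ))) := by ring
    _ ≤ _ := by gcongr

theorem exists_abs_le_of_unitary (hf : ContDiff ℝ ⊤ f) :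
    ∃ R > 0, ∀ V ∈ unitaryGroup (Fin n) ℂ, |f V| ≤ R := by
  obtain ⟨R, hR⟩ := (isCompact_closedBall (0 : Matrix (Fin n) (Fin n) ℂ)
    ‖(1 : Matrix (Fin n) (Fin n) ℂ)‖).exists_bound_of_continuousOn hf.continuous.continuousOn
  refine ⟨|R| + 1, by positivity, fun V hV => ?_⟩
  have h := hR V (by
    rw [mem_closedBall_zero_iff, ← norm_unitary_mul hV 1, mul_one])
  rw [Real.norm_eq_abs] at h
  linarith [le_abs_self R]

theorem isClosed_unitaryGroup : IsClosed (unitaryGroup (Fin n) ℂ : Set (Matrix (Fin n) (Fin n) ℂ)) := by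
  have h : (unitaryGroup (Fin n) ℂ : Set (Matrix (Fin n) (Fin n) ℂ)) = {U | Uᴴ * U = 1} := by
    ext U
    exact mem_unitaryGroup_iff'
  rw [h]
  exact isClosed_eq (continuous_id.matrix_conjTranspose.mul continuous_id) continuous_const

/-- Near a semi-strict local maximum point, Jacobi-G converges linearly to a point of the orbit. -/
theorem IsColumnCost.exists_linear_convergence (hf : IsColumnCost f)
    {U₀ : Matrix (Fin n) (Fin n) ℂ} (hmax : IsMaxNear f U₀) (hU₀ : U₀ ∈ unitaryGroup (Fin n) ℂ)
    (hrank : hessianRank f U₀ = n * (n - 1)) :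
    ∃ ε > 0, ∀ δ : ℝ, 0 < δ → ∀ U : ℕ → unitaryGroup (Fin n) ℂ,
      ‖(U 0 : Matrix (Fin n) (Fin n) ℂ) - U₀‖ < ε → IsJacobiGSequence f δ U →
      ∃ z : Fin n → ℂ, (∀ i, ‖z i‖ = 1) ∧
        ConvergesLinearly (fun k => (U k : Matrix (Fin n) (Fin n) ℂ)) (U₀ * diagonal z) := by
  obtain ⟨r, hr, μ, hμ, K, hK, hest⟩ := hmax.orbit_estimates hf.contDiff hU₀
    (fun z hz => hf.mul_diagonal hz) hrank
  obtain ⟨β, hβ, hcoef⟩ := hf.eventually_coefficients hmax hU₀ hrank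
  -- A gain of at most `β r² / 128` forces a squared step of at most `r² / 8`, so the step is
  -- shorter than `r / 2`.
  obtain ⟨r', hr', hcoef⟩ := Metric.eventually_nhds_iff.1
    (hcoef (β * r ^ 2 / 128) (by positivity))
  obtain ⟨R, hR, hfR⟩ := exists_abs_le_of_unitary hf.contDiff
  set r₁ := min (r / 2) r' with hr₁
  have hr₁0 : 0 < r₁ := by positivity
  have hr₁r : r₁ ≤ r / 2 := min_le_left _ _
  set ε := min r₁ (r₁ * √(μ / (2 * K))) with hε
  have hε0 : 0 < ε := by positivity
  have hKε : K * ε ^ 2 < μ * r₁ ^ 2 := by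
    have h1 : ε ^ 2 ≤ (r₁ * √(μ / (2 * K))) ^ 2 := by
      gcongr
      exact min_le_right _ _
    rw [mul_pow, Real.sq_sqrt (by positivity)] at h1
    calc K * ε ^ 2 ≤ K * (r₁ ^ 2 * (μ / (2 * K))) := by gcongr
      _ = μ * r₁ ^ 2 / 2 := by field_simp
      _ < μ * r₁ ^ 2 := by
        have : 0 < μ * r₁ ^ 2 := by positivity
        linarith
  refine ⟨ε, hε0, fun δ hδ U hU hseq => ?_⟩
  choose V hV z hz hdiag hVU hVn hVmin using fun k => exists_normal_form hU₀ (U k).2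
  have hone : ∀ i : Fin n, ‖(1 : Fin n → ℂ) i‖ = 1 := fun i => by simp
  have hV0 : ‖V 0 - 1‖ < ε := by
    refine (hVmin 0 1 hone).trans_lt ?_
    rwa [Pi.one_def, diagonal_one, mul_one]
  have hVr : ∀ k, ‖V k - 1‖ < r → f (U k) ≤ f U₀ - μ * ‖V k - 1‖ ^ 2 ∧
      f U₀ - f (U k) ≤ K * ‖V k - 1‖ ^ 2 ∧ μ * ‖V k - 1‖ ≤ n * ‖riemannianGradient f (U k)‖ := by
    intro k hk
    have := hest (V k) (hV k) (hdiag k) (z k) (hz k) hk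
    rwa [← hVU k] at this
  have hstep : ∀ k, ‖V k - 1‖ < r₁ →
      β * ‖(U (k + 1) : Matrix (Fin n) (Fin n) ℂ) - U k‖ ^ 2 ≤ 16 * (f (U (k + 1)) - f (U k)) ∧
      f (U (k + 1)) - f (U k) ≤ β * r ^ 2 / 128 ∧
      δ ^ 2 * ‖riemannianGradient f (U k)‖ ^ 2 ≤ 16 * R * (f (U (k + 1)) - f (U k)) := by
    intro k hk
    obtain ⟨i, j, hij, hgrad, Ψ, hΨ, hnext⟩ := hseq k
    have hc := hcoef (y := V k) (by rw [dist_eq_norm]; exact hk.trans_le (min_le_right _ _)) i j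
      hij.ne (z k) (hz k)
    rw [← hVU k] at hc
    have h1 := hf.jacobi_step (U k).2 hij.ne hΨ hβ hc
    have h2 := hf.norm_gradient_restriction_sq_le hij (U k).2 hfR hΨ
    rw [← hnext] at h1 h2
    refine ⟨h1.1, h1.2, le_trans ?_ h2⟩
    rw [← mul_pow]
    gcongr
  -- The step bound alone keeps the next iterate within `r` of the orbit. There `μ w² ≤ f(U_*) -
  -- f(U_0) ≤ K ε² < μ r₁²`, because the values increase, and this restores the smaller radius `r₁`.
  have hinv : ∀ k, ‖V k - 1‖ < r₁ ∧ f (U 0) ≤ f (U k) := by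
    intro k
    induction k with
    | zero => exact ⟨hV0.trans_le (min_le_left _ _), le_rfl⟩
    | succ k ih =>
      obtain ⟨h1, h2, -⟩ := hstep k ih.1
      have hgain : f (U k) ≤ f (U (k + 1)) := by
        have : 0 ≤ β * ‖(U (k + 1) : Matrix (Fin n) (Fin n) ℂ) - U k‖ ^ 2 := by positivity
        linarith
      have hsq : ‖(U (k + 1) : Matrix (Fin n) (Fin n) ℂ) - U k‖ ≤ r / 2 := by
        refine abs_le_of_sq_le_sq' ?_ (by positivity) |>.2
        refine le_of_mul_le_mul_left ?_ hβ
        have : 0 < β * r ^ 2 := by positivity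
        nlinarith
      have hclose : ‖V (k + 1) - 1‖ < r := by
        refine (hVmin (k + 1) (z k) (hz k)).trans_lt ?_
        have h3 := norm_sub_le_norm_sub_add_norm_sub (U (k + 1) : Matrix (Fin n) (Fin n) ℂ) (U k)
          (U₀ * diagonal (z k))
        rw [← hVn k] at h3
        linarith [ih.1]
      obtain ⟨h4, -, -⟩ := hVr (k + 1) hclose
      obtain ⟨-, h5, -⟩ := hVr 0 (by
        have := hV0.trans_le (min_le_left _ _)
        linarith)
      have h6 : K * ‖V 0 - 1‖ ^ 2 ≤ K * ε ^ 2 := by gcongr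
      refine ⟨?_, ih.2.trans hgain⟩
      refine lt_of_pow_lt_pow_left₀ 2 hr₁0.le (lt_of_mul_lt_mul_left ?_ hμ.le)
      linarith [ih.2]
  have hclose : ∀ k, ‖V k - 1‖ < r := fun k => (hinv k).1.trans_le (by linarith)
  -- The chain is: deficit at most `K w²`, `μ w ≤ n ‖grad f‖`, and `δ² ‖grad f‖² ≤ 16 R` times the
  -- gain. The summand `2` only secures `2 ≤ Γ`.
  set Γ : ℝ := K * n ^ 2 * (16 * R) / (μ ^ 2 * δ ^ 2) + 2 with hΓ
  have hΓ2 : 2 ≤ Γ := by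
    have : 0 ≤ K * n ^ 2 * (16 * R) / (μ ^ 2 * δ ^ 2) := by positivity
    linarith
  obtain ⟨L, C, c, hc, hlin, hL, ha⟩ := exists_linear_limit
    (x := fun k => (U k : Matrix (Fin n) (Fin n) ℂ)) (a := fun k => f U₀ - f (U k))
    (M := 16 / β) (Γ := Γ) (by positivity) hΓ2
    (fun k => by
      have h1 := (hVr k (hclose k)).1
      have : 0 ≤ μ * ‖V k - 1‖ ^ 2 := by positivity
      linarith)
    (fun k => by
      have h1 := (hstep k (hinv k).1).1
      rw [div_mul_eq_mul_div, le_div_iff₀ hβ]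
      linarith)
    (fun k => by
      obtain ⟨h1, -, h2⟩ := hstep k (hinv k).1
      obtain ⟨-, h3, h4⟩ := hVr k (hclose k)
      set g := f (U (k + 1)) - f (U k)
      have hg : 0 ≤ g := by
        have : 0 ≤ β * ‖(U (k + 1) : Matrix (Fin n) (Fin n) ℂ) - U k‖ ^ 2 := by positivity
        linarith
      have h5 : (μ * ‖V k - 1‖) ^ 2 ≤ (n * ‖riemannianGradient f (U k)‖) ^ 2 := by gcongr
      have h6 : μ ^ 2 * δ ^ 2 * (f U₀ - f (U k)) ≤ K * n ^ 2 * (16 * R) * g := by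
        calc μ ^ 2 * δ ^ 2 * (f U₀ - f (U k)) ≤ μ ^ 2 * δ ^ 2 * (K * ‖V k - 1‖ ^ 2) := by gcongr
          _ = K * δ ^ 2 * (μ * ‖V k - 1‖) ^ 2 := by ring
          _ ≤ K * δ ^ 2 * (n * ‖riemannianGradient f (U k)‖) ^ 2 := by gcongr
          _ = K * n ^ 2 * (δ ^ 2 * ‖riemannianGradient f (U k)‖ ^ 2) := by ring
          _ ≤ K * n ^ 2 * (16 * R * g) := by gcongr
          _ = _ := by ring
      have h7 : f U₀ - f (U k) ≤ K * n ^ 2 * (16 * R) / (μ ^ 2 * δ ^ 2) * g := by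
        rw [div_mul_eq_mul_div, le_div_iff₀ (by positivity)]
        linarith
      have h8 : f U₀ - f (U k) - (f U₀ - f (U (k + 1))) = g := by ring
      rw [h8, hΓ, add_mul]
      linarith)
  have hLU : L ∈ unitaryGroup (Fin n) ℂ :=
    isClosed_unitaryGroup.mem_of_tendsto hL (Filter.Eventually.of_forall fun k => (U k).2)
  -- The distance from `L` to the orbit is at most `‖L - U k‖ + ‖V k - 1‖` for each `k`, and this
  -- tends to zero since the deficit dominates `μ ‖V k - 1‖²`. Hence `L` is the point `U₀ * diagonal
  -- y`.
  obtain ⟨V', -, y, hy, -, -, hVn', hmin'⟩ := exists_normal_form hU₀ hLU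
  have hVsq : Filter.Tendsto (fun k => ‖V k - 1‖ ^ 2) Filter.atTop (𝓝 0) := by
    have ha' : Filter.Tendsto (fun k => (f U₀ - f (U k)) / μ) Filter.atTop (𝓝 0) := by
      simpa using ha.div_const μ
    refine squeeze_zero (fun k => by positivity) (fun k => ?_) ha'
    rw [le_div_iff₀ hμ]
    linarith [(hVr k (hclose k)).1]
  have hVlim : Filter.Tendsto (fun k => ‖V k - 1‖) Filter.atTop (𝓝 0) := by
    have := hVsq.sqrt
    simpa using this
  have hLlim : Filter.Tendsto (fun k => ‖L - U k‖ + ‖V k - 1‖) Filter.atTop (𝓝 0) := by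
    have h1 : Filter.Tendsto (fun k => ‖L - U k‖) Filter.atTop (𝓝 0) := by
      have := (tendsto_const_nhds (x := L)).sub hL |>.norm
      simpa using this
    simpa using h1.add hVlim
  have hzero : ‖V' - 1‖ ≤ 0 := ge_of_tendsto hLlim (Filter.Eventually.of_forall fun k => by
    have h3 := norm_sub_le_norm_sub_add_norm_sub L (U k : Matrix (Fin n) (Fin n) ℂ)
      (U₀ * diagonal (z k))
    rw [← hVn k] at h3
    exact (hmin' (z k) (hz k)).trans h3)
  rw [hVn', norm_le_zero_iff, sub_eq_zero] at hzero
  refine ⟨y, hy, C, c, hc, ?_⟩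
  rw [← hzero]
  exact hlin

end Step

/-! ### Passage between neighborhoods in the unitary group and norm balls; the theorem -/

theorem IsSemiStrictLocalMax.isMaxNear {n : ℕ} {f : Matrix (Fin n) (Fin n) ℂ → ℝ}
    {U : unitaryGroup (Fin n) ℂ} (h : IsSemiStrictLocalMax f U) : IsMaxNear f U := by
  have h1 := h.1
  rw [IsLocalMax, IsMaxFilter, nhds_subtype_eq_comap, Filter.eventually_comap] at h1
  obtain ⟨r, hr, h2⟩ := Metric.eventually_nhds_iff.1 h1
  exact ⟨r, hr, fun V hV hVr => h2 (y := V) (by rwa [dist_eq_norm]) ⟨V, hV⟩ rfl⟩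

theorem setOf_norm_sub_lt_mem_nhds {n : ℕ} (U : unitaryGroup (Fin n) ℂ) {ε : ℝ} (hε : 0 < ε) :
    {V : unitaryGroup (Fin n) ℂ | ‖(V : Matrix (Fin n) (Fin n) ℂ) - U‖ < ε} ∈ 𝓝 U := by
  have hc : Continuous fun V : unitaryGroup (Fin n) ℂ => ‖(V : Matrix (Fin n) (Fin n) ℂ) - U‖ :=
    (continuous_subtype_val.sub continuous_const).norm
  refine hc.continuousAt.eventually_lt continuousAt_const ?_
  simpa using hε

end JacobiG

theorem mainTheorem1 (n d : ℕ) (hd : d ≤ 3) (f : Matrix (Fin n) (Fin n) ℂ → ℝ)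
    (hf : JacobiG.IsNormCost d f ∨ JacobiG.IsTraceCost d f)
    (Ustar : Matrix.unitaryGroup (Fin n) ℂ) (hU : JacobiG.IsSemiStrictLocalMax f Ustar) :
    ∃ W ∈ 𝓝 Ustar, ∀ δ : ℝ, 0 < δ → δ ≤ √2 / n →
      ∀ U : ℕ → Matrix.unitaryGroup (Fin n) ℂ, U 0 ∈ W → JacobiG.IsJacobiGSequence f δ U →
        ∃ z : Fin n → ℂ, (∀ i, ‖z i‖ = 1) ∧
          JacobiG.ConvergesLinearly (fun k => (U k : Matrix (Fin n) (Fin n) ℂ))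
            (Ustar * Matrix.diagonal z) := by
  have hcost : JacobiG.IsColumnCost f :=
    hf.elim (fun h => h.isColumnCost hd) fun h => h.isColumnCost hd
  obtain ⟨ε, hε, h⟩ := hcost.exists_linear_convergence hU.isMaxNear Ustar.2 hU.2
  exact ⟨_, JacobiG.setOf_norm_sub_lt_mem_nhds Ustar hε, fun δ hδ _ U hU0 hseq =>
    h δ hδ U hU0 hseq⟩
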